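/- Let $\Omega\subseteq\mathbb C$ be an open set and let $\mathcal F\subseteq\mathbb N\times\mathbb N$ contain a sequence $(\tilde p_n,\tilde q_n)_{n\in\mathbb N}$ with $\tilde p_n\to+\infty$ and $\tilde q_n\to+\infty$. Let $A^\infty(\Omega)$ be the space of holomorphic functions $f$ on $\Omega$ such that every derivative $f^{(\ell)}$, $\ell=0,1,2,\dots$, extends continuously to $\overline\Omega$ (the extension is again denoted $f^{(\ell)}$), with the topology of uniform convergence of all derivatives on compact subsets of $\overline\Omega$. Let $X^\infty$ be the closure in $A^\infty(\Omega)$ of the set of (restrictions of) functions that are holomorphic on some open set, depending on the function, containing $\overline\Omega$. For $f\in A^\infty(\Omega)$ and $\zeta\in\overline\Omega$ put $a_v=f^{(v)}(\zeta)/v!$ for $v\ge 0$ and $a_v=0$ for $v<0$. For $p,q\in\{0,1,2,\dots\}$ write $f\in\mathcal D_{p,q}(\zeta)$ if the Hankel determinant $\det(a_{p-q+1+i+j})_{0\le i,j<q}$ is nonzero (for $q=0$ this always holds). In that case let $[p/q]_{f,\zeta}$ be the Padé approximant of $\sum_v a_v(z-\zeta)^v$, that is, the rational function $\sum_{v=0}^p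 n_v(z-\zeta)^v\big/\sum_{v=0}^q d_v(z-\zeta)^v$ with $d_0=1$, whose coefficients $n_v,d_v$ are then uniquely determined, whose Taylor coefficients at $\zeta$ of orders $0,\dots,p+q$ are $a_0,\dots,a_{p+q}$. Consider the following property of $f\in A^\infty(\Omega)$: (P) There is a sequence $(p_n,q_n)_{n\in\mathbb N}$ in $\mathcal F$ such that for every compact set $K\subseteq\overline\Omega$ there is an $n(K)\in\mathbb N$ such that for all $n\ge n(K)$ and all $\zeta\in K$ one has $f\in\mathcal D_{p_n,q_n}(\zeta)$ and $[p_n/q_n]_{f,\zeta}$ has no poles in $K$, and $$\sup_{\zeta\in K}\sup_{z\in K}\bigl|[p_n/q_n]_{f,\zeta}^{(\ell)}(z)-f^{(\ell)}(z)\bigr|\to 0\quad(n\to+\infty)\qquad\text{for every }\ell=0,1,2,\dots$$ Then there exists $f\in A^\infty(\Omega)$ with property (P), and the set of all $f\in X^\infty$ with property (P) is a dense $G_\delta$ subset of $X^\infty$. -/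

import Mathlib

open Filter Topology Polynomial

noncomputable section

namespace PadeGeneric

/-! ### Padé approximants of a formal series `∑ a_v (z - ζ)^v` -/

/-- The coefficient `a_k` for an integer index, with `a_k = 0` for `k < 0`. -/
def intCoeff (a : ℕ → ℂ) (k : ℤ) : ℂ :=
  if k < 0 then 0 else a k.toNat

/-- The `q × q` Hankel matrix whose `(i, j)` entry, `0 ≤ i, j < q`, is `a_{p - q + 1 + i + j}`. -/
def hankel (a : ℕ → ℂ) (p q : ℕ) : Matrix (Fin q) (Fin q) ℂ :=
  Matrix.of fun i j => intCoeff a ((p : ℤ) - (q : ℤ) + 1 + (i : ℕ) + (j : ℕ))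

/-- Numerator `R.1 = ∑_{v ≤ p} n_v w^v` and denominator `R.2 = ∑_{v ≤ q} d_v w^v`, `d_0 = 1`, in the
local variable `w = z - ζ`, of a Padé approximant of type `(p, q)` of `∑ a_v w^v`: the Taylor
series of `R.1 / R.2` has the coefficients `a_0, …, a_{p + q}`. -/
def IsPade (a : ℕ → ℂ) (p q : ℕ) (R : ℂ[X] × ℂ[X]) : Prop :=
  R.1.natDegree ≤ p ∧ R.2.natDegree ≤ q ∧ R.2.coeff 0 = 1 ∧
    ∀ v ≤ p + q, PowerSeries.coeff v ((R.1 : PowerSeries ℂ) * (R.2 : PowerSeries ℂ)⁻¹) = a v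

/-- The pair (numerator, denominator) of the Padé approximant of type `(p, q)`. It is the only
pair satisfying `IsPade a p q` when the Hankel determinant is nonzero (see `existsUnique_isPade`);
it is used only then. -/
def padePair (a : ℕ → ℂ) (p q : ℕ) : ℂ[X] × ℂ[X] :=
  Classical.epsilon (IsPade a p q)

theorem isPade_iff (a : ℕ → ℂ) (p q : ℕ) (R : ℂ[X] × ℂ[X]) :
    IsPade a p q R ↔ R.1.natDegree ≤ p ∧ R.2.natDegree ≤ q ∧ R.2.coeff 0 = 1 ∧
      ∀ v ≤ p + q, PowerSeries.coeff v (PowerSeries.mk a * (R.2 : PowerSeries ℂ)) = R.1.coeff v := by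
  unfold IsPade
  refine and_congr_right fun _ => and_congr_right fun _ => and_congr_right fun h0 => ?_
  set N : PowerSeries ℂ := (R.1 : PowerSeries ℂ)
  set D : PowerSeries ℂ := (R.2 : PowerSeries ℂ) with hD
  have hc : PowerSeries.constantCoeff D ≠ 0 := by
    rw [← PowerSeries.coeff_zero_eq_constantCoeff_apply, hD, Polynomial.coeff_coe, h0]
    exact one_ne_zero
  have e1 : (∀ v ≤ p + q, PowerSeries.coeff v (N * D⁻¹) = a v) ↔
      (PowerSeries.X ^ (p + q + 1) ∣ N * D⁻¹ - PowerSeries.mk a) := by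
    rw [PowerSeries.X_pow_dvd_iff]
    simp [sub_eq_zero]
  have e2 : (∀ v ≤ p + q, PowerSeries.coeff v (PowerSeries.mk a * D) = R.1.coeff v) ↔
      (PowerSeries.X ^ (p + q + 1) ∣ PowerSeries.mk a * D - N) := by
    rw [PowerSeries.X_pow_dvd_iff]
    simp [sub_eq_zero, N]
  rw [e1, e2]
  constructor
  · rintro ⟨c, hcc⟩
    refine ⟨-c * D, ?_⟩
    have : N = N * D⁻¹ * D := by rw [mul_assoc, PowerSeries.inv_mul_cancel _ hc, mul_one]
    rw [this]
    linear_combination (-D) * hcc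
  · rintro ⟨c, hcc⟩
    refine ⟨-c * D⁻¹, ?_⟩
    have : PowerSeries.mk a = PowerSeries.mk a * D * D⁻¹ := by
      rw [mul_assoc, PowerSeries.mul_inv_cancel _ hc, mul_one]
    rw [this]
    linear_combination (-D⁻¹) * hcc

theorem coeff_mk_mul_X_pow (a : ℕ → ℂ) (v k : ℕ) :
    PowerSeries.coeff v (PowerSeries.mk a * PowerSeries.X ^ k) = intCoeff a ((v : ℤ) - k) := by
  rw [PowerSeries.coeff_mul_X_pow']
  unfold intCoeff
  split_ifs with h1 h2 h2
  · omega
  · simp only [PowerSeries.coeff_mk]; congr 1; omega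
  · rfl
  · omega

/-- The polynomial `1 + ∑_{0 ≤ j < q} x_j w^{q - j}`. -/
def denOf (q : ℕ) (x : Fin q → ℂ) : ℂ[X] := 1 + ∑ j : Fin q, C (x j) * X ^ (q - (j : ℕ))

theorem coeff_denOf (a : ℕ → ℂ) (q v : ℕ) (x : Fin q → ℂ) :
    PowerSeries.coeff v (PowerSeries.mk a * (denOf q x : PowerSeries ℂ)) =
      a v + ∑ j : Fin q, intCoeff a ((v : ℤ) - (q - (j : ℕ) : ℕ)) * x j := by
  have : ((denOf q x : ℂ[X]) : PowerSeries ℂ) =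
      1 + ∑ j : Fin q, PowerSeries.C (x j) * PowerSeries.X ^ (q - (j : ℕ)) := by
    unfold denOf
    rw [← Polynomial.coeToPowerSeries.ringHom_apply]
    simp only [map_add, map_one, map_sum, map_mul, map_pow,
      Polynomial.coeToPowerSeries.ringHom_apply, Polynomial.coe_C, Polynomial.coe_X]
  rw [this, mul_add, mul_one, map_add, Finset.mul_sum, map_sum, PowerSeries.coeff_mk]
  congr 1
  refine Finset.sum_congr rfl fun j _ => ?_
  rw [mul_left_comm, PowerSeries.coeff_C_mul, coeff_mk_mul_X_pow, mul_comm]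

theorem denOf_coeff (D : ℂ[X]) (q : ℕ) (hd : D.natDegree ≤ q) (h0 : D.coeff 0 = 1) :
    denOf q (fun j => D.coeff (q - (j : ℕ))) = D := by
  ext k
  unfold denOf
  simp only [Polynomial.coeff_add, Polynomial.finsetSum_coeff, Polynomial.coeff_C_mul_X_pow,
    Polynomial.coeff_one]
  rcases Nat.eq_zero_or_pos k with rfl | hk
  · rw [Finset.sum_eq_zero]
    · simp [h0]
    · intro j _; rw [if_neg]; have := j.2; omega
  · rw [if_neg (by omega), zero_add]
    by_cases hkq : k ≤ q
    · rw [Finset.sum_eq_single (⟨q - k, by omega⟩ : Fin q)]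
      · have : q - (q - k) = k := by omega
        simp [this]
      · intro j _ hj
        rw [if_neg]
        intro h; apply hj; ext; have := j.2; simp; omega
      · simp
    · rw [Polynomial.coeff_eq_zero_of_natDegree_lt (by omega), Finset.sum_eq_zero]
      intro j _; rw [if_neg]; omega

theorem hankel_iff (a : ℕ → ℂ) (p q : ℕ) (x : Fin q → ℂ) :
    Matrix.mulVec (hankel a p q) x = (fun i : Fin q => - a (p + 1 + i)) ↔
    ∀ v, p < v → v ≤ p + q →
      PowerSeries.coeff v (PowerSeries.mk a * (denOf q x : PowerSeries ℂ)) = 0 := by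
  have key : ∀ i : Fin q, (hankel a p q).mulVec x i =
      ∑ j : Fin q, intCoeff a (((p + 1 + i : ℕ) : ℤ) - (q - (j : ℕ) : ℕ)) * x j := by
    intro i
    simp only [Matrix.mulVec, dotProduct, hankel, Matrix.of_apply]
    refine Finset.sum_congr rfl fun j _ => ?_
    congr 2
    have := j.2
    omega
  constructor
  · intro h v h1 h2
    have := congrFun h ⟨v - (p + 1), by omega⟩
    rw [key] at this
    have e : p + 1 + (v - (p + 1)) = v := by omega
    simp only [e] at this
    rw [coeff_denOf, this]; ring
  · intro h
    ext i
    have := h (p + 1 + i) (by omega) (by have := i.2; omega)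
    rw [coeff_denOf] at this
    rw [key]
    linear_combination this

/-- The Padé pair exists and is unique when the Hankel determinant is nonzero. -/
theorem existsUnique_isPade (a : ℕ → ℂ) (p q : ℕ) (h : (hankel a p q).det ≠ 0) :
    ∃! R, IsPade a p q R := by
  have hu : IsUnit (hankel a p q).det := isUnit_iff_ne_zero.2 h
  obtain ⟨x, hx⟩ : ∃ x, Matrix.mulVec (hankel a p q) x = (fun i : Fin q => - a (p + 1 + i)) :=
    ⟨Matrix.mulVec (hankel a p q)⁻¹ _, by
      rw [Matrix.mulVec_mulVec, Matrix.mul_nonsing_inv _ hu, Matrix.one_mulVec]⟩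
  have hinj : Function.Injective (Matrix.mulVec (hankel a p q)) :=
    Matrix.mulVec_injective_iff_isUnit.2 ((Matrix.isUnit_iff_isUnit_det _).2 hu)
  refine ⟨(PowerSeries.trunc (p + 1) (PowerSeries.mk a * (denOf q x : PowerSeries ℂ)), denOf q x),
    ?_, ?_⟩
  · beta_reduce
    rw [isPade_iff]
    refine ⟨Nat.lt_succ_iff.1 (PowerSeries.natDegree_trunc_lt _ _), ?_, ?_, ?_⟩
    · unfold denOf
      refine (Polynomial.natDegree_add_le _ _).trans (max_le (by simp) ?_)
      refine Polynomial.natDegree_sum_le_of_forall_le _ _ fun j _ => ?_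
      exact (Polynomial.natDegree_C_mul_X_pow_le _ _).trans (by omega)
    · unfold denOf
      simp only [Polynomial.coeff_add, Polynomial.finsetSum_coeff,
        Polynomial.coeff_C_mul_X_pow, Polynomial.coeff_one_zero]
      rw [Finset.sum_eq_zero, add_zero]
      intro j _; rw [if_neg]; have := j.2; omega
    · intro v hv
      rw [PowerSeries.coeff_trunc]
      split_ifs with h1
      · rfl
      · exact (hankel_iff a p q x).1 hx v (by omega) hv
  · rintro ⟨N, D⟩ hR
    rw [isPade_iff] at hR
    obtain ⟨hN, hD, h0, hc⟩ := hR
    simp only at hN hD h0 hc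
    have hDx := denOf_coeff D q hD h0
    have : (fun j : Fin q => D.coeff (q - (j : ℕ))) = x := by
      apply hinj
      rw [hx]
      rw [hankel_iff]
      intro v h1 h2
      rw [hDx, hc v h2, Polynomial.coeff_eq_zero_of_natDegree_lt (by omega)]
    rw [this] at hDx
    subst hDx
    congr 1
    ext v
    rw [PowerSeries.coeff_trunc]
    split_ifs with h1
    · exact (hc v (by omega)).symm
    · exact Polynomial.coeff_eq_zero_of_natDegree_lt (by omega)

theorem padePair_spec (a : ℕ → ℂ) (p q : ℕ) (h : (hankel a p q).det ≠ 0) :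
    IsPade a p q (padePair a p q) :=
  Classical.epsilon_spec (existsUnique_isPade a p q h).exists

/-! ### The spaces `A^∞(Ω)` and `X^∞` -/

/-- The space `A^∞(Ω)`. A holomorphic function `h` on `Ω` all of whose derivatives extend
continuously to `closure Ω` is represented by the sequence `f` of these extensions: `f l` is the
continuous extension of `h^(l)`. (The sequence is determined by `h` since `Ω` is dense in its
closure, and it determines `h = f 0` on `Ω`.) The topology of the subtype is the one induced by the
product of the compact-open topologies, i.e. uniform convergence of every derivative on every
compact subset of `closure Ω`. -/
def AInf (Ω : Set ℂ) : Set (ℕ → C(closure Ω, ℂ)) :=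
  {f | ∃ h : ℂ → ℂ, DifferentiableOn ℂ h Ω ∧
    ∀ (l : ℕ) (z : closure Ω), (z : ℂ) ∈ Ω → f l z = iteratedDeriv l h z}

/-- `f^(l)` on `closure Ω`; on the boundary it is defined by continuity. -/
def der {Ω : Set ℂ} (f : AInf Ω) (l : ℕ) (z : closure Ω) : ℂ :=
  (f : ℕ → C(closure Ω, ℂ)) l z

/-- `H(closure Ω)` inside `A^∞(Ω)`: the restrictions of the functions that are holomorphic on some
open set (depending on the function) containing `closure Ω`. -/
def holomorphicNear (Ω : Set ℂ) : Set (AInf Ω) :=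
  {f | ∃ (U : Set ℂ) (h : ℂ → ℂ), IsOpen U ∧ closure Ω ⊆ U ∧ DifferentiableOn ℂ h U ∧
    ∀ z : closure Ω, der f 0 z = h z}

/-- `X^∞`, the closure of `H(closure Ω)` in `A^∞(Ω)`. -/
def XInf (Ω : Set ℂ) : Set (AInf Ω) :=
  closure (holomorphicNear Ω)

/-! ### Padé approximants of a function in `A^∞(Ω)` with centre `ζ ∈ closure Ω` -/

/-- The coefficients `f^(v)(ζ) / v!`. -/
def taylorCoeff {Ω : Set ℂ} (f : AInf Ω) (ζ : closure Ω) (v : ℕ) : ℂ :=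
  der f v ζ / (v.factorial : ℂ)

/-- `f ∈ 𝒟_{p,q}(ζ)`: the Hankel determinant of the Taylor coefficients of `f` at `ζ` is nonzero
(an empty determinant being `1`, this always holds for `q = 0`). -/
def InD {Ω : Set ℂ} (f : AInf Ω) (p q : ℕ) (ζ : closure Ω) : Prop :=
  (hankel (taylorCoeff f ζ) p q).det ≠ 0

/-- The numerator of `[p/q]_{f,ζ}` as a function of `z`. -/
def padeNum {Ω : Set ℂ} (f : AInf Ω) (p q : ℕ) (ζ : closure Ω) (z : ℂ) : ℂ :=
  (padePair (taylorCoeff f ζ) p q).1.eval (z - ζ)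

/-- The denominator of `[p/q]_{f,ζ}` as a function of `z`. -/
def padeDen {Ω : Set ℂ} (f : AInf Ω) (p q : ℕ) (ζ : closure Ω) (z : ℂ) : ℂ :=
  (padePair (taylorCoeff f ζ) p q).2.eval (z - ζ)

/-- The Padé approximant `[p/q]_{f,ζ}` as a function of `z`. -/
def pade {Ω : Set ℂ} (f : AInf Ω) (p q : ℕ) (ζ : closure Ω) (z : ℂ) : ℂ :=
  padeNum f p q ζ z / padeDen f p q ζ z

/-- There is one sequence `(p_n, q_n)` in `𝓕` such that for every compact `K ⊆ closure Ω`: for all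
large `n` and all centres `ζ ∈ K` one has `f ∈ 𝒟_{p_n,q_n}(ζ)` and `[p_n/q_n]_{f,ζ}` has no pole on
`K`, and for every `l` the derivatives `[p_n/q_n]_{f,ζ}^(l)(z)` converge to `f^(l)(z)` uniformly in
`(ζ, z) ∈ K × K`. -/
def HasPadeApproximation {Ω : Set ℂ} (𝓕 : Set (ℕ × ℕ)) (f : AInf Ω) : Prop :=
  ∃ p q : ℕ → ℕ, (∀ n, (p n, q n) ∈ 𝓕) ∧
    ∀ K : Set (closure Ω), IsCompact K →
      (∃ n₀ : ℕ, ∀ n ≥ n₀, ∀ ζ ∈ K,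
        InD f (p n) (q n) ζ ∧ ∀ z ∈ K, padeDen f (p n) (q n) ζ z ≠ 0) ∧
      ∀ l : ℕ, TendstoUniformlyOn
        (fun (n : ℕ) (x : closure Ω × closure Ω) =>
          iteratedDeriv l (pade f (p n) (q n) x.1) (x.2 : ℂ))
        (fun x : closure Ω × closure Ω => der f l x.2) atTop (K ×ˢ K)

end PadeGeneric

end

noncomputable section

namespace PadeGeneric

/-! The proof is a Baire category argument in `XInf Ω`, which is complete with a countably generated
uniformity and hence a Baire space. Property (P) is equivalent to countably many conditions: for
each `n`, some `(p, q) ∈ 𝓕` gives Padé approximants that are pole-free and within `1 / (n + 1)` on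
the disc of radius `n`, for derivatives up to order `n` (`hasPadeApproximation_iff`). So it suffices
that each condition is open and dense.

Openness (`isOpen_goodSet`): where the Hankel determinant is nonzero, Cramer's rule makes the Padé
coefficients continuous in the function and the centre, and compactness of the set of pairs (centre,
point) does the rest.

Density rests on two facts. By Runge's theorem, applied to the part of `closure Ω` in a disc,
rational functions with poles off `closure Ω` are dense in `XInf Ω`; Runge's theorem is derived here
from the Cauchy–Pompeiu formula. Moreover a rational function `N / D` in lowest terms with `deg N =
p` exactly and `deg D ≤ q` is its own approximant of type `(p, q)` at every centre
(`padePair_of_rational`). Given any coprime `N`, `D`, a pair `(p, q) ∈ 𝓕` with both entries large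
and a small `c ≠ 0`, the function `N / D + c z ^ (p - deg D)` has this form and is close to `N / D`;
its approximation error is zero (`ofRational_mem_closure_goodSet`). -/

/-! ### Rational functions as their own Padé approximants -/

theorem coeff_denOf_sub (q : ℕ) (x : Fin q → ℂ) (j : Fin q) :
    (denOf q x).coeff (q - (j : ℕ)) = x j := by
  unfold denOf
  have := j.2
  simp only [Polynomial.coeff_add, Polynomial.finsetSum_coeff, Polynomial.coeff_C_mul_X_pow,
    Polynomial.coeff_one]
  rw [if_neg (by omega), zero_add, Finset.sum_eq_single j]
  · simp
  · intro i _ hi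
    rw [if_neg]
    intro h
    apply hi
    ext
    have := i.2
    omega
  · simp

theorem denOf_injective (q : ℕ) : Function.Injective (denOf q) := fun x y h => by
  ext j
  rw [← coeff_denOf_sub q x j, h, coeff_denOf_sub]

theorem coeff_zero_denOf (q : ℕ) (x : Fin q → ℂ) : (denOf q x).coeff 0 = 1 := by
  unfold denOf
  simp only [Polynomial.coeff_add, Polynomial.finsetSum_coeff,
    Polynomial.coeff_C_mul_X_pow, Polynomial.coeff_one_zero]
  rw [Finset.sum_eq_zero, add_zero]
  intro j _; rw [if_neg]; have := j.2; omega

theorem natDegree_denOf_le (q : ℕ) (x : Fin q → ℂ) : (denOf q x).natDegree ≤ q := by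
  unfold denOf
  refine (Polynomial.natDegree_add_le _ _).trans (max_le (by simp) ?_)
  refine Polynomial.natDegree_sum_le_of_forall_le _ _ fun j _ => ?_
  exact (Polynomial.natDegree_C_mul_X_pow_le _ _).trans (by omega)

theorem eq_zero_of_X_pow_dvd {P : ℂ[X]} {n : ℕ} (h : P.natDegree < n)
    (hd : (PowerSeries.X ^ n : PowerSeries ℂ) ∣ (P : PowerSeries ℂ)) : P = 0 := by
  ext k
  rw [Polynomial.coeff_zero]
  by_cases hk : k < n
  · rw [PowerSeries.X_pow_dvd_iff] at hd
    simpa using hd k hk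
  · exact Polynomial.coeff_eq_zero_of_natDegree_lt (by omega)

/-- A solution `x` yields a second pair `N'`, `D'` representing the series up to order `p + q`. The
difference `N * D' - N' * D` has degree at most `p + q` and vanishes to order `p + q + 1`, so it is
zero. Coprimality gives `D' = D * c` and `N' = N * c`; since `deg N' ≤ p = deg N`, the factor `c` is
constant, and the constant terms make it `1`. -/
theorem denOf_eq_of_mulVec_hankel {a : ℕ → ℂ} {q : ℕ} {N D : ℂ[X]}
    (h : PowerSeries.mk a * (D : PowerSeries ℂ) = N) (hN : N ≠ 0) (hD : D.natDegree ≤ q)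
    (hc : IsCoprime N D) (h0 : D.coeff 0 = 1) {x : Fin q → ℂ}
    (hx : Matrix.mulVec (hankel a N.natDegree q) x = fun i : Fin q => - a (N.natDegree + 1 + i)) :
    denOf q x = D := by
  set p := N.natDegree with hp
  rw [hankel_iff] at hx
  set N' : ℂ[X] := PowerSeries.trunc (p + 1) (PowerSeries.mk a * (denOf q x : PowerSeries ℂ))
    with hN'
  have hdeg : N'.natDegree ≤ p := Nat.lt_succ_iff.1 (PowerSeries.natDegree_trunc_lt _ _)
  have hdvd : (PowerSeries.X ^ (p + q + 1) : PowerSeries ℂ) ∣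
      PowerSeries.mk a * (denOf q x : PowerSeries ℂ) - N' := by
    rw [PowerSeries.X_pow_dvd_iff]
    intro v hv
    rw [map_sub, Polynomial.coeff_coe, hN', PowerSeries.coeff_trunc]
    split_ifs with h1
    · simp
    · rw [hx v (by omega) (by omega), sub_zero]
  have hzero : N * denOf q x - N' * D = 0 := by
    apply eq_zero_of_X_pow_dvd (n := p + q + 1)
    · refine lt_of_le_of_lt (Polynomial.natDegree_sub_le _ _) (Nat.lt_succ_of_le (max_le ?_ ?_))
      · exact (Polynomial.natDegree_mul_le).trans (add_le_add le_rfl (natDegree_denOf_le q x))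
      · exact (Polynomial.natDegree_mul_le).trans (add_le_add hdeg hD)
    · obtain ⟨c, hcc⟩ := hdvd
      refine ⟨c * D, ?_⟩
      push_cast
      rw [← h]
      linear_combination (D : PowerSeries ℂ) * hcc
  rw [sub_eq_zero] at hzero
  obtain ⟨c, hcD⟩ : D ∣ denOf q x := hc.symm.dvd_of_dvd_mul_left ⟨N', by rw [hzero, mul_comm]⟩
  have hD0 : D ≠ 0 := by rintro rfl; simp at h0
  have hNc : N' = N * c := by
    apply mul_right_cancel₀ hD0
    rw [← hzero, hcD]; ring
  have hc0 : c ≠ 0 := by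
    rintro rfl
    have := coeff_zero_denOf q x
    rw [hcD] at this
    simp at this
  have hcdeg : c.natDegree = 0 := by
    rw [hNc, Polynomial.natDegree_mul hN hc0] at hdeg
    omega
  rw [Polynomial.eq_C_of_natDegree_eq_zero hcdeg] at hcD
  have h1 := coeff_zero_denOf q x
  rw [hcD, Polynomial.coeff_mul_C, h0, one_mul] at h1
  rw [hcD, h1]
  simp

/-- If `∑ a_v w^v = N / D` in lowest terms, with `deg N = p` exactly and `deg D ≤ q`, then the
Hankel determinant of type `(p, q)` does not vanish. -/
theorem hankel_det_ne_zero_of_isCoprime {a : ℕ → ℂ} {q : ℕ} {N D : ℂ[X]}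
    (h : PowerSeries.mk a * (D : PowerSeries ℂ) = N) (hN : N ≠ 0) (hD : D.natDegree ≤ q)
    (hc : IsCoprime N D) (h0 : D.coeff 0 = 1) :
    (hankel a N.natDegree q).det ≠ 0 := by
  intro hdet
  -- Adding a kernel vector to the solution given by `D` would produce a second solution of the
  -- inhomogeneous system, against the uniqueness just shown.
  obtain ⟨y, hy0, hy⟩ := Matrix.exists_mulVec_eq_zero_iff.2 hdet
  have hx : Matrix.mulVec (hankel a N.natDegree q) (fun j : Fin q => D.coeff (q - (j : ℕ))) =
      fun i : Fin q => - a (N.natDegree + 1 + i) := by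
    rw [hankel_iff, denOf_coeff D q hD h0, h]
    intro v hv _
    rw [Polynomial.coeff_coe, Polynomial.coeff_eq_zero_of_natDegree_lt hv]
  have h1 := denOf_eq_of_mulVec_hankel h hN hD hc h0 hx
  have h2 := denOf_eq_of_mulVec_hankel h hN hD hc h0
    (x := (fun j : Fin q => D.coeff (q - (j : ℕ))) + y)
    (by rw [Matrix.mulVec_add, hx, hy, add_zero])
  apply hy0
  have := denOf_injective q (h1.trans h2.symm)
  simpa using this.symm

theorem padePair_eq_of_isCoprime {a : ℕ → ℂ} {q : ℕ} {N D : ℂ[X]}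
    (h : PowerSeries.mk a * (D : PowerSeries ℂ) = N) (hN : N ≠ 0) (hD : D.natDegree ≤ q)
    (hc : IsCoprime N D) (h0 : D.coeff 0 = 1) :
    padePair a N.natDegree q = (N, D) := by
  have hdet := hankel_det_ne_zero_of_isCoprime h hN hD hc h0
  refine (existsUnique_isPade a _ q hdet).unique (padePair_spec a _ q hdet) ?_
  rw [isPade_iff]
  exact ⟨le_rfl, hD, h0, fun v _ => by rw [h, Polynomial.coeff_coe]⟩

theorem iteratedDeriv_eval (P : ℂ[X]) (n : ℕ) (z : ℂ) :
    iteratedDeriv n (fun z => P.eval z) z = n.factorial * (taylor z P).coeff n := by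
  have hd : (n.factorial : ℂ[X]) * hasseDeriv n P = derivative^[n] P := by
    rw [← Polynomial.factorial_smul_hasseDeriv, LinearMap.smul_apply, nsmul_eq_mul]
  rw [Polynomial.taylor_coeff, ← Polynomial.eval_natCast_mul, hd]
  have : ∀ n, iteratedDeriv n (fun z => P.eval z) = fun z => (derivative^[n] P).eval z := by
    intro n
    induction n with
    | zero => simp
    | succ n ih =>
      rw [iteratedDeriv_succ, ih, Function.iterate_succ_apply']
      ext z
      simp
  rw [this]

theorem analyticAt_eval (P : ℂ[X]) (z : ℂ) : AnalyticAt ℂ (fun z => P.eval z) z := by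
  simpa [Polynomial.aeval_def] using AnalyticAt.aeval_polynomial (analyticAt_id (𝕜 := ℂ) (z := z)) P

/-- The Taylor series of `g` at `ζ` times that of the polynomial `D` is that of the polynomial `N`
if `g * D = N` near `ζ`. -/
theorem mk_iteratedDeriv_mul_taylor {g : ℂ → ℂ} {N D : ℂ[X]} {ζ : ℂ} (hg : AnalyticAt ℂ g ζ)
    (h : ∀ᶠ z in 𝓝 ζ, g z * D.eval z = N.eval z) :
    PowerSeries.mk (fun v => iteratedDeriv v g ζ / (v.factorial : ℂ)) *
      ((taylor ζ D : ℂ[X]) : PowerSeries ℂ) = (taylor ζ N : ℂ[X]) := by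
  ext n
  have h1 : iteratedDeriv n (g * fun z => D.eval z) ζ = iteratedDeriv n (fun z => N.eval z) ζ :=
    Filter.EventuallyEq.iteratedDeriv_eq n h
  have hn : (n.factorial : ℂ) ≠ 0 := by exact_mod_cast n.factorial_ne_zero
  have hD : ContDiffAt ℂ n (fun z => D.eval z) ζ := (analyticAt_eval D ζ).contDiffAt
  rw [iteratedDeriv_mul hg.contDiffAt hD, iteratedDeriv_eval] at h1
  -- The Leibniz rule divided by `n!` is the Cauchy product of the Taylor series.
  rw [Polynomial.coeff_coe, ← mul_right_inj' hn, ← h1, PowerSeries.coeff_mul, Finset.mul_sum,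
    Finset.Nat.sum_antidiagonal_eq_sum_range_succ
      (fun i j => (n.factorial : ℂ) * (PowerSeries.coeff i _ * PowerSeries.coeff j _))]
  refine Finset.sum_congr rfl fun i hi => ?_
  rw [iteratedDeriv_eval, PowerSeries.coeff_mk, Polynomial.coeff_coe]
  have hi' : i ≤ n := Nat.lt_succ_iff.1 (Finset.mem_range.1 hi)
  have h2 := Nat.choose_mul_factorial_mul_factorial hi'
  have h3 : (n.factorial : ℂ) = n.choose i * i.factorial * (n - i).factorial := by
    exact_mod_cast h2.symm
  have hi0 : (i.factorial : ℂ) ≠ 0 := by exact_mod_cast i.factorial_ne_zero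
  rw [h3]
  field_simp

theorem analyticAt_div_eval (N D : ℂ[X]) {z : ℂ} (hz : D.eval z ≠ 0) :
    AnalyticAt ℂ (fun z => N.eval z / D.eval z) z :=
  (analyticAt_eval N z).div (analyticAt_eval D z) hz

/-- A rational function `N / D` in lowest terms, of numerator degree exactly `p` and denominator
degree at most `q`, is its own Padé approximant of type `(p, q)` at every centre. -/
theorem padePair_of_rational {Ω : Set ℂ} {f : AInf Ω} {N D : ℂ[X]} {q : ℕ} (hN : N ≠ 0)
    (hD : D.natDegree ≤ q) (hc : IsCoprime N D) (hD0 : ∀ z ∈ closure Ω, D.eval z ≠ 0)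
    (hf : ∀ (l : ℕ) (z : closure Ω),
      der f l z = iteratedDeriv l (fun z => N.eval z / D.eval z) z) (ζ : closure Ω) :
    InD f N.natDegree q ζ ∧ (∀ z ∈ closure Ω, padeDen f N.natDegree q ζ z ≠ 0) ∧
      pade f N.natDegree q ζ = fun z => N.eval z / D.eval z := by
  have hζ := hD0 ζ ζ.2
  -- Scaling both polynomials by `1 / D(ζ)` gives the denominator constant term `1` in the variable
  -- centred at `ζ`.
  set c : ℂ := (D.eval (ζ : ℂ))⁻¹ with hcdef
  have hc0 : c ≠ 0 := inv_ne_zero hζ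
  have key : PowerSeries.mk (taylorCoeff f ζ) * ((C c * taylor (ζ : ℂ) D : ℂ[X]) : PowerSeries ℂ) =
      (C c * taylor (ζ : ℂ) N : ℂ[X]) := by
    have h1 : taylorCoeff f ζ = fun v =>
        iteratedDeriv v (fun z => N.eval z / D.eval z) ζ / (v.factorial : ℂ) := by
      ext v; rw [taylorCoeff, hf]
    have hev : ∀ᶠ z in 𝓝 (ζ : ℂ), N.eval z / D.eval z * D.eval z = N.eval z := by
      filter_upwards [D.continuous.continuousAt.eventually_ne hζ] with z hz
      exact div_mul_cancel₀ _ hz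
    have := mk_iteratedDeriv_mul_taylor (analyticAt_div_eval N D hζ) hev
    rw [h1]
    push_cast
    rw [mul_left_comm, this]
  have hdegN : (C c * taylor (ζ : ℂ) N).natDegree = N.natDegree := by
    rw [Polynomial.natDegree_C_mul hc0, Polynomial.natDegree_taylor]
  have hdegD : (C c * taylor (ζ : ℂ) D).natDegree ≤ q := by
    rwa [Polynomial.natDegree_C_mul hc0, Polynomial.natDegree_taylor]
  have hN' : C c * taylor (ζ : ℂ) N ≠ 0 :=
    mul_ne_zero (by simpa using hc0) (by simpa using hN)
  have hu : IsUnit (C c : ℂ[X]) := Polynomial.isUnit_C.2 (isUnit_iff_ne_zero.2 hc0)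
  have hcop : IsCoprime (C c * taylor (ζ : ℂ) N) (C c * taylor (ζ : ℂ) D) := by
    rw [isCoprime_mul_unit_left hu]
    exact hc.map (Polynomial.taylorAlgHom (ζ : ℂ)).toRingHom
  have hone : (C c * taylor (ζ : ℂ) D).coeff 0 = 1 := by
    rw [Polynomial.coeff_C_mul, Polynomial.taylor_coeff_zero, hcdef, inv_mul_cancel₀ hζ]
  have hdet := hankel_det_ne_zero_of_isCoprime key hN' hdegD hcop hone
  have hpair := padePair_eq_of_isCoprime key hN' hdegD hcop hone
  rw [hdegN] at hdet hpair
  refine ⟨hdet, fun z hz => ?_, ?_⟩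
  · rw [padeDen, hpair]
    simpa [Polynomial.taylor_eval] using ⟨hc0, hD0 z hz⟩
  · ext z
    rw [pade, padeNum, padeDen, hpair]
    simp only [Polynomial.eval_mul, Polynomial.eval_C, Polynomial.taylor_eval, sub_add_cancel]
    rw [mul_div_mul_left _ _ hc0]

/-! ### Continuous dependence of Padé approximants on the coefficients -/

/-- The nontrivial denominator coefficients of the Padé approximant, obtained by solving the
Hankel system. -/
def denVec (a : ℕ → ℂ) (p q : ℕ) : Fin q → ℂ :=
  Matrix.mulVec (hankel a p q)⁻¹ fun i : Fin q => - a (p + 1 + i)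

theorem padePair_snd {a : ℕ → ℂ} {p q : ℕ} (h : (hankel a p q).det ≠ 0) :
    (padePair a p q).2 = denOf q (denVec a p q) := by
  have hu : IsUnit (hankel a p q).det := isUnit_iff_ne_zero.2 h
  have hs := padePair_spec a p q h
  rw [isPade_iff] at hs
  obtain ⟨hN, hD, h0, hc⟩ := hs
  rw [← denOf_coeff _ q hD h0]
  congr 1
  have : Matrix.mulVec (hankel a p q) (fun j : Fin q => (padePair a p q).2.coeff (q - (j : ℕ))) =
      fun i : Fin q => - a (p + 1 + i) := by
    rw [hankel_iff, denOf_coeff _ q hD h0]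
    intro v h1 h2
    rw [hc v h2, Polynomial.coeff_eq_zero_of_natDegree_lt (by omega)]
  rw [denVec, ← this, Matrix.mulVec_mulVec, Matrix.nonsing_inv_mul _ hu, Matrix.one_mulVec]

theorem padePair_fst_coeff {a : ℕ → ℂ} {p q : ℕ} (h : (hankel a p q).det ≠ 0) (v : ℕ) :
    (padePair a p q).1.coeff v = if v ≤ p then
      a v + ∑ j : Fin q, intCoeff a ((v : ℤ) - (q - (j : ℕ) : ℕ)) * denVec a p q j else 0 := by
  have hs := padePair_spec a p q h
  rw [isPade_iff] at hs
  obtain ⟨hN, hD, h0, hc⟩ := hs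
  split_ifs with hv
  · rw [← hc v (by omega), padePair_snd h, coeff_denOf]
  · exact Polynomial.coeff_eq_zero_of_natDegree_lt (by omega)

section Continuity

variable {T : Type*} [TopologicalSpace T]

/-- A family of polynomials, locally of bounded degree, whose coefficients are continuous at `t`. -/
def PolyContinuousAt (P : T → ℂ[X]) (t : T) : Prop :=
  (∃ d, ∀ᶠ s in 𝓝 t, (P s).natDegree ≤ d) ∧ ∀ k, ContinuousAt (fun s => (P s).coeff k) t

namespace PolyContinuousAt

variable {P Q : T → ℂ[X]} {t : T}

theorem mul (hP : PolyContinuousAt P t) (hQ : PolyContinuousAt Q t) :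
    PolyContinuousAt (fun s => P s * Q s) t := by
  obtain ⟨⟨d, hd⟩, hP⟩ := hP
  obtain ⟨⟨e, he⟩, hQ⟩ := hQ
  refine ⟨⟨d + e, ?_⟩, fun k => ?_⟩
  · filter_upwards [hd, he] with s h1 h2
    exact Polynomial.natDegree_mul_le.trans (add_le_add h1 h2)
  · simp only [Polynomial.coeff_mul]
    exact tendsto_finsetSum _ fun i _ => (hP i.1).mul (hQ i.2)

theorem sub (hP : PolyContinuousAt P t) (hQ : PolyContinuousAt Q t) :
    PolyContinuousAt (fun s => P s - Q s) t := by
  obtain ⟨⟨d, hd⟩, hP⟩ := hP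
  obtain ⟨⟨e, he⟩, hQ⟩ := hQ
  refine ⟨⟨max d e, ?_⟩, fun k => ?_⟩
  · filter_upwards [hd, he] with s h1 h2
    exact (Polynomial.natDegree_sub_le _ _).trans (max_le_max h1 h2)
  · simp only [Polynomial.coeff_sub]
    exact (hP k).sub (hQ k)

theorem derivative (hP : PolyContinuousAt P t) :
    PolyContinuousAt (fun s => Polynomial.derivative (P s)) t := by
  obtain ⟨⟨d, hd⟩, hP⟩ := hP
  refine ⟨⟨d, ?_⟩, fun k => ?_⟩
  · filter_upwards [hd] with s h1
    exact (Polynomial.natDegree_derivative_le _).trans ((Nat.sub_le _ _).trans h1)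
  · simp only [Polynomial.coeff_derivative]
    exact (hP _).mul continuousAt_const

theorem const (R : ℂ[X]) : PolyContinuousAt (fun _ : T => R) t :=
  ⟨⟨R.natDegree, by simp⟩, fun _ => continuousAt_const⟩

theorem eval (hP : PolyContinuousAt P t) {w : T → ℂ} (hw : ContinuousAt w t) :
    ContinuousAt (fun s => (P s).eval (w s)) t := by
  obtain ⟨⟨d, hd⟩, hP⟩ := hP
  have : ContinuousAt (fun s => ∑ k ∈ Finset.range (d + 1), (P s).coeff k * w s ^ k) t :=
    tendsto_finsetSum _ fun k _ => (hP k).mul (hw.pow k)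
  refine this.congr ?_
  filter_upwards [hd] with s hs
  rw [Polynomial.eval_eq_sum_range' (Nat.lt_succ_of_le hs)]

end PolyContinuousAt

theorem continuousAt_intCoeff {a : T → ℕ → ℂ} {t : T} (ha : ∀ v, ContinuousAt (fun s => a s v) t)
    (k : ℤ) : ContinuousAt (fun s => intCoeff (a s) k) t := by
  unfold intCoeff
  split_ifs
  · exact continuousAt_const
  · exact ha _

theorem continuousAt_hankel {a : T → ℕ → ℂ} {t : T} (ha : ∀ v, ContinuousAt (fun s => a s v) t)
    (p q : ℕ) : ContinuousAt (fun s => hankel (a s) p q) t :=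
  continuousAt_pi.2 fun _ => continuousAt_pi.2 fun _ => continuousAt_intCoeff ha _

theorem continuousAt_det_hankel {a : T → ℕ → ℂ} {t : T}
    (ha : ∀ v, ContinuousAt (fun s => a s v) t) (p q : ℕ) :
    ContinuousAt (fun s => (hankel (a s) p q).det) t :=
  (continuous_id.matrix_det.continuousAt).comp (continuousAt_hankel ha p q)

/-- By Cramer's rule the solution is a polynomial in the coefficients divided by the Hankel
determinant. -/
theorem continuousAt_denVec {a : T → ℕ → ℂ} {t : T} (ha : ∀ v, ContinuousAt (fun s => a s v) t)
    {p q : ℕ} (h : (hankel (a t) p q).det ≠ 0) (j : Fin q) :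
    ContinuousAt (fun s => denVec (a s) p q j) t := by
  have h1 : ContinuousAt (fun s => (hankel (a s) p q).adjugate) t :=
    (continuous_id.matrix_adjugate.continuousAt).comp (continuousAt_hankel ha p q)
  have h2 := (continuousAt_det_hankel ha p q).inv₀ h
  have : (fun s => denVec (a s) p q j) = fun s => ∑ i : Fin q,
      ((hankel (a s) p q).det⁻¹ * (hankel (a s) p q).adjugate j i) * - a s (p + 1 + i) := by
    ext s
    simp [denVec, Matrix.mulVec, dotProduct, Matrix.inv_def, Ring.inverse_eq_inv']
  rw [this]
  refine tendsto_finsetSum _ fun i _ => (h2.mul ?_).mul (ha _).neg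
  exact continuousAt_pi.1 (continuousAt_pi.1 h1 j) i

/-- Where the determinant vanishes `padePair` may be an arbitrary choice; the determinant is nonzero
throughout a neighbourhood of `t`, so the explicit formula can be used there. -/
theorem polyContinuousAt_padePair_snd {a : T → ℕ → ℂ} {t : T}
    (ha : ∀ v, ContinuousAt (fun s => a s v) t) {p q : ℕ} (h : (hankel (a t) p q).det ≠ 0) :
    PolyContinuousAt (fun s => (padePair (a s) p q).2) t := by
  have hev := (continuousAt_det_hankel ha p q).eventually_ne h
  refine ⟨⟨q, ?_⟩, fun k => ?_⟩
  · filter_upwards [hev] with s hs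
    exact (padePair_spec _ p q hs).2.1
  · have : ContinuousAt (fun s => (denOf q (denVec (a s) p q)).coeff k) t := by
      unfold denOf
      simp only [Polynomial.coeff_add, Polynomial.finsetSum_coeff, Polynomial.coeff_C_mul_X_pow]
      refine continuousAt_const.add (tendsto_finsetSum _ fun j _ => ?_)
      split_ifs
      · exact continuousAt_denVec ha h j
      · exact tendsto_const_nhds
    refine this.congr ?_
    filter_upwards [hev] with s hs
    rw [padePair_snd hs]

theorem polyContinuousAt_padePair_fst {a : T → ℕ → ℂ} {t : T}
    (ha : ∀ v, ContinuousAt (fun s => a s v) t) {p q : ℕ} (h : (hankel (a t) p q).det ≠ 0) :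
    PolyContinuousAt (fun s => (padePair (a s) p q).1) t := by
  have hev := (continuousAt_det_hankel ha p q).eventually_ne h
  refine ⟨⟨p, ?_⟩, fun k => ?_⟩
  · filter_upwards [hev] with s hs
    exact (padePair_spec _ p q hs).1
  · have : ContinuousAt (fun s => if k ≤ p then
        a s k + ∑ j : Fin q, intCoeff (a s) ((k : ℤ) - (q - (j : ℕ) : ℕ)) * denVec (a s) p q j
        else 0) t := by
      split_ifs
      · exact (ha k).add (tendsto_finsetSum _ fun j _ =>
          (continuousAt_intCoeff ha _).mul (continuousAt_denVec ha h j))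
      · exact continuousAt_const
    refine this.congr ?_
    filter_upwards [hev] with s hs
    rw [padePair_fst_coeff hs]

/-- The numerator of the `l`-th derivative of `N / D` over the denominator `D ^ (l + 1)`. -/
def derivNum (N D : ℂ[X]) : ℕ → ℂ[X]
  | 0 => N
  | l + 1 => derivative (derivNum N D l) * D - ((l : ℂ[X]) + 1) * (derivNum N D l * derivative D)

theorem PolyContinuousAt.derivNum {N D : T → ℂ[X]} {t : T} (hN : PolyContinuousAt N t)
    (hD : PolyContinuousAt D t) (l : ℕ) :
    PolyContinuousAt (fun s => derivNum (N s) (D s) l) t := by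
  induction l with
  | zero => exact hN
  | succ l ih => exact (ih.derivative.mul hD).sub ((const _).mul (ih.mul hD.derivative))

end Continuity

theorem iteratedDeriv_div_eval (N D : ℂ[X]) (l : ℕ) {z : ℂ} (hz : D.eval z ≠ 0) :
    iteratedDeriv l (fun z => N.eval z / D.eval z) z =
      (derivNum N D l).eval z / D.eval z ^ (l + 1) := by
  induction l generalizing z with
  | zero => simp [derivNum]
  | succ l ih =>
    have hev : iteratedDeriv l (fun z => N.eval z / D.eval z) =ᶠ[𝓝 z]
        fun z => (derivNum N D l).eval z / D.eval z ^ (l + 1) := by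
      filter_upwards [D.continuous.continuousAt.eventually_ne hz] with w hw using ih hw
    rw [iteratedDeriv_succ, hev.deriv_eq]
    have h1 := ((derivNum N D l).hasDerivAt z).div ((D.hasDerivAt z).pow (l + 1))
      (pow_ne_zero _ hz)
    refine (h1.deriv.trans ?_)
    simp only [derivNum, Polynomial.eval_sub, Polynomial.eval_mul, Polynomial.eval_add,
      Polynomial.eval_natCast, Polynomial.eval_one, Pi.pow_apply]
    push_cast
    field_simp
    ring

theorem iteratedDeriv_pade {Ω : Set ℂ} (f : AInf Ω) (p q l : ℕ) (ζ : closure Ω) {z : ℂ}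
    (hz : padeDen f p q ζ z ≠ 0) :
    iteratedDeriv l (pade f p q ζ) z =
      (derivNum (padePair (taylorCoeff f ζ) p q).1 (padePair (taylorCoeff f ζ) p q).2 l).eval
        (z - ζ) / padeDen f p q ζ z ^ (l + 1) := by
  rw [padeDen] at hz ⊢
  rw [← iteratedDeriv_div_eval _ _ _ hz]
  exact congrFun (iteratedDeriv_comp_sub_const l
    (fun w => (padePair (taylorCoeff f ζ) p q).1.eval w /
      (padePair (taylorCoeff f ζ) p q).2.eval w) (ζ : ℂ)) z

/-! ### Openness of the approximation conditions -/

instance locallyCompactSpace_closure (Ω : Set ℂ) : LocallyCompactSpace (closure Ω) :=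
  isClosed_closure.isClosedEmbedding_subtypeVal.locallyCompactSpace

instance sigmaCompactSpace_closure (Ω : Set ℂ) : SigmaCompactSpace (closure Ω) :=
  isClosed_closure.isClosedEmbedding_subtypeVal.sigmaCompactSpace

/-- Evaluation is jointly continuous for the compact-open topology because `closure Ω` is locally
compact. -/
theorem continuous_der (Ω : Set ℂ) (l : ℕ) :
    Continuous fun x : AInf Ω × closure Ω => der x.1 l x.2 := by
  have h : Continuous fun x : AInf Ω × closure Ω =>
      (((x.1 : ℕ → C(closure Ω, ℂ)) l, x.2) : C(closure Ω, ℂ) × closure Ω) :=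
    (((continuous_apply l).comp continuous_subtype_val).comp continuous_fst).prodMk continuous_snd
  exact continuous_eval.comp h

/-- The functions whose Padé approximants of type `(p, q)` centred in `K` have no poles in `K` and
approximate them on `K` within `ε`, together with the derivatives up to order `n`. -/
def goodSet {Ω : Set ℂ} (K : Set (closure Ω)) (n : ℕ) (ε : ℝ) (p q : ℕ) : Set (AInf Ω) :=
  {f | ∀ x ∈ K ×ˢ K, InD f p q x.1 ∧ padeDen f p q x.1 x.2 ≠ 0 ∧
    ∀ l ≤ n, ‖iteratedDeriv l (pade f p q x.1) x.2 - der f l x.2‖ < ε}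

/-- Every condition is strict and depends continuously on function, centre and point together, so it
persists near each `(f, x)`; compactness of `K ×ˢ K` provides one neighbourhood of `f` for all `x`.
-/
theorem isOpen_goodSet {Ω : Set ℂ} {K : Set (closure Ω)} (hK : IsCompact K) (n : ℕ) (ε : ℝ)
    (p q : ℕ) : IsOpen (goodSet K n ε p q) := by
  rw [isOpen_iff_mem_nhds]
  intro f hf
  refine (hK.prod hK).eventually_forall_of_forall_eventually fun x hx => ?_
  obtain ⟨h1, h2, h3⟩ := hf x hx
  set t : AInf Ω × (closure Ω × closure Ω) := (f, x)
  have ha : ∀ v, ContinuousAt (fun s : AInf Ω × (closure Ω × closure Ω) =>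
      taylorCoeff s.1 s.2.1 v) t := fun v => by
    refine (ContinuousAt.div_const ?_ _)
    exact ((continuous_der Ω v).comp
      (continuous_fst.prodMk (continuous_fst.comp continuous_snd))).continuousAt
  have hN := polyContinuousAt_padePair_fst ha h1
  have hD := polyContinuousAt_padePair_snd ha h1
  have hw : ContinuousAt (fun s : AInf Ω × (closure Ω × closure Ω) =>
      (s.2.2 : ℂ) - (s.2.1 : ℂ)) t := by fun_prop
  have hden : ContinuousAt (fun s : AInf Ω × (closure Ω × closure Ω) =>
      padeDen s.1 p q s.2.1 s.2.2) t := hD.eval hw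
  have hne := hden.eventually_ne h2
  have hl : ∀ l ∈ Finset.range (n + 1), ∀ᶠ s : AInf Ω × (closure Ω × closure Ω) in 𝓝 t,
      ‖iteratedDeriv l (pade s.1 p q s.2.1) s.2.2 - der s.1 l s.2.2‖ < ε := by
    intro l hl
    have hc : ContinuousAt (fun s : AInf Ω × (closure Ω × closure Ω) =>
        ‖iteratedDeriv l (pade s.1 p q s.2.1) s.2.2 - der s.1 l s.2.2‖) t := by
      refine ContinuousAt.norm (ContinuousAt.sub ?_ ?_)
      · refine (((hN.derivNum hD l).eval hw).div (hden.pow (l + 1)) (pow_ne_zero _ h2)).congr ?_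
        filter_upwards [hne] with s hs
        exact (iteratedDeriv_pade s.1 p q l s.2.1 hs).symm
      · exact ((continuous_der Ω l).comp
          (continuous_fst.prodMk (continuous_snd.comp continuous_snd))).continuousAt
    exact hc.eventually_lt continuousAt_const (h3 l (Nat.lt_succ_iff.1 (Finset.mem_range.1 hl)))
  filter_upwards [(continuousAt_det_hankel ha p q).eventually_ne h1, hne,
    (Filter.eventually_all_finset _).2 hl] with s hs1 hs2 hs3
  exact ⟨hs1, hs2, fun l hl => hs3 l (Finset.mem_range.2 (Nat.lt_succ_of_le hl))⟩

/-! ### The Cauchy–Pompeiu formula and Cauchy transforms -/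

section CauchyPompeiu

open MeasureTheory Set

/-- The Wirtinger derivative `∂g/∂w̄`. -/
def dbar (g : ℂ → ℂ) (w : ℂ) : ℂ :=
  (1 / 2) * (fderiv ℝ g w 1 + Complex.I * fderiv ℝ g w Complex.I)

theorem continuous_dbar {g : ℂ → ℂ} (hg : ContDiff ℝ 1 g) : Continuous (dbar g) := by
  have h := hg.continuous_fderiv one_ne_zero
  unfold dbar
  fun_prop

/-- The point `cos θ + i sin θ` of the unit circle. -/
def unitVec (θ : ℝ) : ℂ := (Real.cos θ : ℂ) + (Real.sin θ : ℂ) * Complex.I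

theorem unitVec_mul_conj (θ : ℝ) :
    unitVec θ * ((Real.cos θ : ℂ) - (Real.sin θ : ℂ) * Complex.I) = 1 := by
  have h : (Real.cos θ : ℂ) ^ 2 + (Real.sin θ : ℂ) ^ 2 = 1 := by
    exact_mod_cast Real.cos_sq_add_sin_sq θ
  rw [unitVec]
  linear_combination h - (Real.sin θ : ℂ) ^ 2 * Complex.I_sq

theorem norm_unitVec (θ : ℝ) : ‖unitVec θ‖ = 1 := by
  rw [unitVec, Complex.ofReal_cos, Complex.ofReal_sin, ← Complex.exp_mul_I,
    Complex.norm_exp_ofReal_mul_I]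

theorem continuous_unitVec : Continuous unitVec := by
  unfold unitVec
  fun_prop

theorem hasDerivAt_unitVec (θ : ℝ) : HasDerivAt unitVec (Complex.I * unitVec θ) θ := by
  have h := ((Real.hasDerivAt_cos θ).ofReal_comp).add
    (((Real.hasDerivAt_sin θ).ofReal_comp).mul_const Complex.I)
  refine h.congr_deriv ?_
  rw [unitVec]
  push_cast
  linear_combination -(Complex.sin θ : ℂ) * Complex.I_sq

variable {g : ℂ → ℂ}

/-- The Jacobian `r` cancels the singularity of `1 / w`. What remains is half of `∂_r g + (i / r)
∂_θ g`, whose two terms are integrated separately. -/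
theorem dbar_polar (r θ : ℝ) (hr : 0 < r) :
    r • (dbar g (r * unitVec θ) / (r * unitVec θ)) = (1 / 2) *
      (fderiv ℝ g (r * unitVec θ) (unitVec θ) +
        Complex.I * fderiv ℝ g (r * unitVec θ) (Complex.I * unitVec θ)) := by
  set D := fderiv ℝ g (r * unitVec θ) with hD
  have h1 : D (unitVec θ) = Real.cos θ * D 1 + Real.sin θ * D Complex.I := by
    have : unitVec θ = Real.cos θ • (1 : ℂ) + Real.sin θ • Complex.I := by
      simp [unitVec]
    rw [this, map_add, map_smul, map_smul]
    simp
  have h2 : D (Complex.I * unitVec θ) = Real.cos θ * D Complex.I - Real.sin θ * D 1 := by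
    have : Complex.I * unitVec θ = Real.cos θ • Complex.I - Real.sin θ • (1 : ℂ) := by
      simp only [unitVec, Complex.real_smul]
      linear_combination (Real.sin θ : ℂ) * Complex.I_sq
    rw [this, map_sub, map_smul, map_smul]
    simp
  have hr' : (r : ℂ) ≠ 0 := by exact_mod_cast hr.ne'
  have hu := unitVec_mul_conj θ
  have hu0 : unitVec θ ≠ 0 := left_ne_zero_of_mul_eq_one hu
  rw [h1, h2, dbar, ← hD, Complex.real_smul]
  have h3 : (r : ℂ) * ((1 / 2) * (D 1 + Complex.I * D Complex.I) / (r * unitVec θ)) =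
      (1 / 2) * (D 1 + Complex.I * D Complex.I) *
        (unitVec θ * ((Real.cos θ : ℂ) - (Real.sin θ : ℂ) * Complex.I)) / unitVec θ := by
    rw [hu]; field_simp
  rw [h3, mul_comm (unitVec θ), ← mul_assoc, mul_div_cancel_right₀ _ hu0]
  linear_combination (-1 / 2 * (Real.sin θ : ℂ) * D Complex.I) * Complex.I_sq

theorem integrableOn_polar {F : ℝ × ℝ → ℂ} (hF : Continuous F) {R : ℝ}
    (hR : ∀ p : ℝ × ℝ, R < p.1 → F p = 0) :
    IntegrableOn F (Ioi (0 : ℝ) ×ˢ Ioo (-Real.pi) Real.pi) := by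
  have h : IntegrableOn F (Icc (0 : ℝ) R ×ˢ Icc (-Real.pi) Real.pi) :=
    hF.continuousOn.integrableOn_compact (isCompact_Icc.prod isCompact_Icc)
  refine h.of_forall_sdiff_eq_zero (measurableSet_Ioi.prod measurableSet_Ioo) fun p hp => hR p ?_
  obtain ⟨⟨h1, h2⟩, h3⟩ := hp
  by_contra h4
  exact h3 ⟨⟨le_of_lt h1, not_lt.1 h4⟩, Ioo_subset_Icc_self h2⟩

/-- The **Cauchy–Pompeiu formula** for a compactly supported function, at the origin. -/
theorem integral_dbar_div_self (hg : ContDiff ℝ 1 g) (hc : HasCompactSupport g) :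
    ∫ w, dbar g w / w = -(Real.pi : ℂ) * g 0 := by
  obtain ⟨R, hR⟩ : ∃ R, ∀ w : ℂ, R < ‖w‖ → w ∉ tsupport g := by
    obtain ⟨R, hR⟩ := hc.isCompact.isBounded.subset_closedBall 0
    exact ⟨R, fun w hw h => lt_irrefl _ (hw.trans_le (by simpa using hR h))⟩
  have hnorm : ∀ r θ : ℝ, R < r → R < ‖(r : ℂ) * unitVec θ‖ := fun r θ h => by
    rw [norm_mul, norm_unitVec, mul_one, Complex.norm_real]
    exact h.trans_le (le_abs_self r)
  have hfd0 : ∀ r θ : ℝ, R < r → fderiv ℝ g (r * unitVec θ) = 0 := fun r θ h =>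
    fderiv_of_notMem_tsupport ℝ (hR _ (hnorm r θ h))
  set A : ℝ × ℝ → ℂ := fun p => fderiv ℝ g (p.1 * unitVec p.2) (unitVec p.2) with hA
  set B : ℝ × ℝ → ℂ := fun p => fderiv ℝ g (p.1 * unitVec p.2) (Complex.I * unitVec p.2) with hB
  have hcg := hg.continuous_fderiv one_ne_zero
  have hcu := continuous_unitVec
  have hAc : Continuous A := by fun_prop
  have hBc : Continuous B := by fun_prop
  have hAi := integrableOn_polar hAc (R := R) fun p hp => by simp only [hA, hfd0 _ _ hp]; rfl
  have hBi := integrableOn_polar hBc (R := R) fun p hp => by simp only [hB, hfd0 _ _ hp]; rfl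
  have hgd : ∀ w, HasFDerivAt g (fderiv ℝ g w) w := fun w =>
    (hg.differentiable one_ne_zero w).hasFDerivAt
  -- Radial term: on each ray the fundamental theorem of calculus gives `-g 0`, and the angles
  -- contribute the factor `2π`.
  have hIA : ∫ p in Ioi (0 : ℝ) ×ˢ Ioo (-Real.pi) Real.pi, A p = -(2 * Real.pi) * g 0 := by
    have hr : ∀ θ : ℝ, ∫ r in Ioi (0 : ℝ), A (r, θ) = - g 0 := fun θ => by
      have h1 : ContDiff ℝ 1 fun r : ℝ => g (r * unitVec θ) :=
        hg.comp (Complex.ofRealCLM.contDiff.mul contDiff_const)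
      have h2 : HasCompactSupport fun r : ℝ => g (r * unitVec θ) := by
        refine HasCompactSupport.intro (isCompact_closedBall (0 : ℝ) R) fun r hr => ?_
        have : R < ‖(r : ℂ) * unitVec θ‖ := by
          rw [norm_mul, norm_unitVec, mul_one, Complex.norm_real]
          simpa using hr
        exact image_eq_zero_of_notMem_tsupport (hR _ this)
      have h3 := HasCompactSupport.integral_Ioi_deriv_eq h1 h2 0
      simp only [Complex.ofReal_zero, zero_mul] at h3
      rw [← h3]
      congr 1
      ext r
      have h4 : HasDerivAt (fun r : ℝ => (r : ℂ) * unitVec θ) (1 * unitVec θ) r :=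
        (HasDerivAt.ofReal_comp (hasDerivAt_id r)).mul_const _
      rw [one_mul] at h4
      exact ((hgd _).comp_hasDerivAt r h4).deriv.symm
    rw [Measure.volume_eq_prod, setIntegral_prod _ hAi]
    rw [integral_integral_swap (f := fun r θ => A (r, θ))]
    · simp only [hr]
      rw [setIntegral_const, Real.volume_real_Ioo_of_le (by linarith [Real.pi_pos])]
      simp only [Complex.real_smul]
      push_cast
      ring
    · rw [Measure.prod_restrict]
      exact hAi
  -- Angular term: on each circle the integrand is the derivative of a periodic function.
  have hIB : ∫ p in Ioi (0 : ℝ) ×ˢ Ioo (-Real.pi) Real.pi, B p = 0 := by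
    rw [Measure.volume_eq_prod, setIntegral_prod _ hBi]
    refine setIntegral_eq_zero_of_forall_eq_zero fun r hr => ?_
    have hr' : (r : ℂ) ≠ 0 := by exact_mod_cast (ne_of_gt hr)
    rw [← integral_Ioc_eq_integral_Ioo,
      ← intervalIntegral.integral_of_le (by linarith [Real.pi_pos])]
    have hd : ∀ θ : ℝ, HasDerivAt (fun θ : ℝ => (r : ℂ)⁻¹ * g (r * unitVec θ)) (B (r, θ)) θ := by
      intro θ
      have h4 := (hasDerivAt_unitVec θ).const_mul (r : ℂ)
      have h5 := ((hgd _).comp_hasDerivAt θ h4).const_mul (r : ℂ)⁻¹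
      refine h5.congr_deriv ?_
      have : (r : ℂ) * (Complex.I * unitVec θ) = r • (Complex.I * unitVec θ) := by simp
      rw [this, map_smul, Complex.real_smul, inv_mul_cancel_left₀ hr']
    rw [intervalIntegral.integral_eq_sub_of_hasDerivAt (fun θ _ => hd θ)
      ((hBc.comp (by fun_prop : Continuous fun θ : ℝ => (r, θ))).intervalIntegrable _ _)]
    simp [unitVec]
  rw [← Complex.integral_comp_polarCoord_symm,
    show polarCoord.target = Ioi (0 : ℝ) ×ˢ Ioo (-Real.pi) Real.pi from rfl,
    setIntegral_congr_fun (g := fun p => (1 / 2 : ℂ) * A p + (1 / 2 * Complex.I) * B p)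
      (measurableSet_Ioi.prod measurableSet_Ioo),
    integral_add (hAi.const_mul _) (hBi.const_mul _), integral_const_mul, integral_const_mul,
    hIA, hIB]
  · ring
  · rintro ⟨r, θ⟩ ⟨hr, -⟩
    simp only [Complex.polarCoord_symm_apply]
    refine (dbar_polar r θ hr).trans ?_
    simp only [hA, hB]
    ring

/-- The **Cauchy–Pompeiu formula** for a compactly supported function. -/
theorem integral_dbar_div_sub (hg : ContDiff ℝ 1 g) (hc : HasCompactSupport g) (z : ℂ) :
    ∫ w, dbar g w / (w - z) = -(Real.pi : ℂ) * g z := by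
  have h1 : ContDiff ℝ 1 fun w => g (w + z) := hg.comp (contDiff_id.add contDiff_const)
  have h2 : HasCompactSupport fun w => g (w + z) := hc.comp_homeomorph (Homeomorph.addRight z)
  have h := integral_dbar_div_self h1 h2
  rw [zero_add] at h
  rw [← h, ← integral_add_right_eq_self _ z]
  congr 1
  ext w
  simp only [add_sub_cancel_right, dbar, fderiv_comp_add_right]

/-- A function holomorphic on a neighbourhood `U` of a compact set `L` is, near `L`, a Cauchy
transform of a continuous density on a compact subset of `U` at positive distance from `L`. -/
theorem exists_cauchy_transform {U L : Set ℂ} (hU : IsOpen U) (hL : IsCompact L) (hLU : L ⊆ U)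
    {h : ℂ → ℂ} (hh : DifferentiableOn ℂ h U) :
    ∃ (V T : Set ℂ) (φ : ℂ → ℂ), IsOpen V ∧ L ⊆ V ∧ V ⊆ U ∧ IsCompact T ∧ Disjoint V T ∧
      Continuous φ ∧ ∀ z ∈ V, h z = ∫ w in T, φ w / (w - z) := by
  obtain ⟨L₂, hL₂, hLL₂, hL₂U⟩ := exists_compact_between hL hU hLU
  obtain ⟨χ, hχ1, hχ0, -⟩ := exists_contMDiffMap_one_nhds_of_subset_interior (n := 1)
    (modelWithCornersSelf ℝ ℂ) hL.isClosed hLL₂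
  have hχ : ContDiff ℝ 1 χ := χ.contMDiff.contDiff
  obtain ⟨V, hV, hLV, hV1⟩ := mem_nhdsSet_iff_exists.1 hχ1
  have hV1' : ∀ z ∈ V, χ z = 1 := fun z hz => hV1 hz
  have hVL₂ : V ⊆ L₂ := fun z hz => by
    by_contra h
    have := hV1' z hz
    rw [hχ0 z h] at this
    exact zero_ne_one this
  -- The cut-off equals `1` on `V` and `0` off `L₂`. Hence `dbar g` vanishes on `V`, where `g = h`
  -- is holomorphic, and off `L₂`, so the Cauchy–Pompeiu integral lives on `L₂ \ V`.
  set g : ℂ → ℂ := fun w => (χ w : ℂ) * h w with hgdef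
  have hg0 : ∀ w ∉ L₂, g w = 0 := fun w hw => by simp [hgdef, hχ0 w hw]
  have hgc : HasCompactSupport g := HasCompactSupport.intro hL₂ hg0
  have hg : ContDiff ℝ 1 g := by
    rw [contDiff_iff_contDiffAt]
    intro w
    by_cases hw : w ∈ U
    · have h1 : ContDiffAt ℂ 1 h w := (hh.analyticAt (hU.mem_nhds hw)).contDiffAt
      exact (Complex.ofRealCLM.contDiff.comp hχ).contDiffAt.mul (h1.restrict_scalars ℝ)
    · have : g =ᶠ[𝓝 w] fun _ => 0 := by
        filter_upwards [hL₂.isClosed.isOpen_compl.mem_nhds fun h => hw (hL₂U h)] with x hx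
        exact hg0 x hx
      exact contDiffAt_const.congr_of_eventuallyEq this
  have hdV : ∀ w ∈ V, dbar g w = 0 := fun w hw => by
    have h1 : g =ᶠ[𝓝 w] h := by
      filter_upwards [hV.mem_nhds hw] with x hx
      simp [hgdef, hV1' x hx]
    have h2 : HasFDerivAt h ((fderiv ℂ h w).restrictScalars ℝ) w :=
      (hh.differentiableAt (hU.mem_nhds (hL₂U (hVL₂ hw)))).hasFDerivAt.restrictScalars ℝ
    have h3 : fderiv ℂ h w Complex.I = Complex.I * fderiv ℂ h w 1 := by
      rw [← smul_eq_mul, ← map_smul, smul_eq_mul, mul_one]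
    rw [dbar, h1.fderiv_eq, h2.fderiv]
    simp only [ContinuousLinearMap.coe_restrictScalars', h3]
    linear_combination (1 / 2 * fderiv ℂ h w 1) * Complex.I_sq
  refine ⟨V, L₂ \ V, fun w => -(Real.pi : ℂ)⁻¹ * dbar g w, hV, hLV, hVL₂.trans hL₂U,
    hL₂.diff hV, disjoint_sdiff_right, continuous_const.mul (continuous_dbar hg), fun z hz => ?_⟩
  rw [setIntegral_eq_integral_of_forall_compl_eq_zero]
  · have hpi : (Real.pi : ℂ) ≠ 0 := by exact_mod_cast Real.pi_ne_zero
    simp only [mul_div_assoc]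
    rw [integral_const_mul, integral_dbar_div_sub hg hgc, neg_mul, neg_mul, mul_neg, neg_neg, inv_mul_cancel_left₀ hpi]
    simp [hgdef, hV1' z hz]
  · intro w hw
    have : dbar g w = 0 := by
      by_cases hwV : w ∈ V
      · exact hdV w hwV
      · have hw2 : w ∉ L₂ := fun h => hw ⟨h, hwV⟩
        have : g =ᶠ[𝓝 w] fun _ => 0 := by
          filter_upwards [hL₂.isClosed.isOpen_compl.mem_nhds hw2] with x hx
          exact hg0 x hx
        rw [dbar, this.fderiv_eq]
        simp
    simp [this]

end CauchyPompeiu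

/-! ### Runge's theorem with control of derivatives -/

section Runge

open MeasureTheory Set

/-- For a nonzero finite measure the integral is a multiple of the average, which stays in a closed
convex set. -/
theorem integral_mem_of_isClosed {α E : Type*} [MeasurableSpace α] [NormedAddCommGroup E]
    [NormedSpace ℝ E] [CompleteSpace E] {μ : Measure α} [IsFiniteMeasure μ] {W : Submodule ℝ E}
    (hW : IsClosed (W : Set E)) {F : α → E} (hF : Integrable F μ) (h : ∀ x, F x ∈ W) :
    ∫ x, F x ∂μ ∈ W := by
  rcases eq_or_ne μ 0 with rfl | hμ
  · simp
  · have : NeZero μ := ⟨hμ⟩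
    rw [← measure_smul_average]
    exact W.smul_mem _ (W.convex.average_mem hW (Eventually.of_forall h) hF)

/-- The restrictions to `L` of the rational functions without poles on `S ⊇ L`. -/
def rationalOn (S L : Set ℂ) (hLS : L ⊆ S) : Subalgebra ℂ C(L, ℂ) where
  carrier := {f | ∃ N D : ℂ[X], (∀ z ∈ S, D.eval z ≠ 0) ∧
    ∀ z : L, f z = N.eval (z : ℂ) / D.eval (z : ℂ)}
  mul_mem' := by
    rintro f g ⟨N, D, hD, hf⟩ ⟨N', D', hD', hg⟩
    refine ⟨N * N', D * D', fun z hz => ?_, fun z => ?_⟩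
    · rw [Polynomial.eval_mul]
      exact mul_ne_zero (hD z hz) (hD' z hz)
    · rw [ContinuousMap.mul_apply, hf, hg, Polynomial.eval_mul, Polynomial.eval_mul,
        div_mul_div_comm]
  add_mem' := by
    rintro f g ⟨N, D, hD, hf⟩ ⟨N', D', hD', hg⟩
    refine ⟨N * D' + D * N', D * D', fun z hz => ?_, fun z => ?_⟩
    · rw [Polynomial.eval_mul]
      exact mul_ne_zero (hD z hz) (hD' z hz)
    · rw [ContinuousMap.add_apply, hf, hg, Polynomial.eval_add, Polynomial.eval_mul,
        Polynomial.eval_mul, Polynomial.eval_mul, div_add_div _ _ (hD z (hLS z.2))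
          (hD' z (hLS z.2))]
  algebraMap_mem' := fun c => ⟨C c, 1, by simp, by simp⟩

theorem id_mem_rationalOn (S L : Set ℂ) (hLS : L ⊆ S) :
    (⟨fun z : L => (z : ℂ), continuous_subtype_val⟩ : C(L, ℂ)) ∈ rationalOn S L hLS :=
  ⟨X, 1, by simp, by simp⟩

/-- A pole outside a disc containing `L` may be moved to infinity. -/
theorem cauchyKernel_mem_closure {S L : Set ℂ} (hLS : L ⊆ S) [CompactSpace L] {w : ℂ}
    {k : C(L, ℂ)} (hk : ∀ z : L, k z * (w - z) = 1) (hw : w ∉ S ∨ ∀ z ∈ L, ‖z‖ < ‖w‖) :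
    k ∈ (rationalOn S L hLS).topologicalClosure := by
  rcases hw with hw | hw
  · refine subset_closure ⟨1, C w - X, fun z hz => ?_, fun z => ?_⟩
    · rw [Polynomial.eval_sub, Polynomial.eval_C, Polynomial.eval_X, sub_ne_zero]
      rintro rfl
      exact hw hz
    · have := hk z
      simp only [Polynomial.eval_sub, Polynomial.eval_C, Polynomial.eval_X, Polynomial.eval_one]
      exact eq_one_div_of_mul_eq_one_left this
  · rcases isEmpty_or_nonempty L with hL | ⟨⟨z₀⟩⟩
    · have : k = 0 := by ext z; exact isEmptyElim z
      rw [this]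
      exact zero_mem _
    have hw0 : w ≠ 0 := norm_pos_iff.1 ((norm_nonneg _).trans_lt (hw z₀ z₀.2))
    -- Expand `1 / (w - z) = w⁻¹ ∑ (z / w) ^ n`, a series of polynomials that converges uniformly
    -- since `|z / w|` is bounded below `1` on the compact set `L`.
    set ι : C(L, ℂ) := ⟨fun z : L => (z : ℂ), continuous_subtype_val⟩
    set u : C(L, ℂ) := w⁻¹ • ι with hu
    have hu1 : ‖u‖ < 1 := by
      rw [ContinuousMap.norm_lt_iff _ one_pos]
      intro z
      have : u z = w⁻¹ * z := rfl
      rw [this, norm_mul, norm_inv, inv_mul_lt_one₀ (norm_pos_iff.2 hw0)]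
      exact hw z z.2
    have hum : u ∈ rationalOn S L hLS := Subalgebra.smul_mem _ (id_mem_rationalOn S L hLS) _
    have hsum := (summable_geometric_of_norm_lt_one hu1).hasSum
    have hmem : (∑' n, u ^ n) ∈ (rationalOn S L hLS).topologicalClosure :=
      (rationalOn S L hLS).isClosed_topologicalClosure.mem_of_tendsto hsum
        (Eventually.of_forall fun s => Subalgebra.sum_mem _ fun n _ =>
          Subalgebra.pow_mem _ ((rationalOn S L hLS).le_topologicalClosure hum) n)
    have hgeo := geom_series_mul_neg u hu1
    have : k = w⁻¹ • ∑' n, u ^ n := by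
      ext z
      have h1 := congrArg (fun f : C(L, ℂ) => f z) hgeo
      simp only [ContinuousMap.mul_apply, ContinuousMap.sub_apply, ContinuousMap.one_apply] at h1
      have h2 : u z = w⁻¹ * z := rfl
      have h3 : w⁻¹ * (w - z) = 1 - u z := by rw [h2]; field_simp
      have h4 := hk z
      have h5 : w - (z : ℂ) ≠ 0 := right_ne_zero_of_mul_eq_one h4
      rw [ContinuousMap.smul_apply, smul_eq_mul]
      apply mul_right_cancel₀ h5
      rw [h4, mul_right_comm, h3, mul_comm, h1]
    rw [this]
    exact Subalgebra.smul_mem _ hmem _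

/-- The Cauchy transform is a Bochner integral, in `C(L, ℂ)`, of multiples of Cauchy kernels. Each
kernel lies in the closed subalgebra, so the integral does too. -/
theorem mem_closure_of_cauchy_transform {S L T : Set ℂ} (hLS : L ⊆ S) [CompactSpace L]
    (hT : IsCompact T) (hLT : Disjoint L T) (hST : ∀ w ∈ T, w ∈ S → ∀ z ∈ L, ‖z‖ < ‖w‖)
    {φ : ℂ → ℂ} (hφ : Continuous φ) {f : C(L, ℂ)}
    (hf : ∀ z : L, f z = ∫ w in T, φ w / (w - z)) :
    f ∈ (rationalOn S L hLS).topologicalClosure := by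
  have := isCompact_iff_compactSpace.1 hT
  have hne : ∀ x : T × L, (x.1 : ℂ) - x.2 ≠ 0 := fun x h =>
    Set.disjoint_left.1 hLT x.2.2 (by rw [← sub_eq_zero.1 h]; exact x.1.2)
  let κ : C(T × L, ℂ) := ⟨fun x => ((x.1 : ℂ) - x.2)⁻¹,
    Continuous.inv₀ (by fun_prop) hne⟩
  let F : T → C(L, ℂ) := fun w => φ w • κ.curry w
  have hFc : Continuous F := (hφ.comp continuous_subtype_val).smul κ.curry.continuous
  let μ : Measure T := Measure.comap Subtype.val volume
  have : IsFiniteMeasure μ := ⟨by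
    rw [comap_subtype_coe_apply hT.measurableSet, image_univ, Subtype.range_coe]
    exact hT.measure_lt_top⟩
  obtain ⟨M, hM⟩ := (isCompact_range hFc).isBounded.exists_norm_le
  have hFi : Integrable F μ := Integrable.of_bound hFc.aestronglyMeasurable M
    (Eventually.of_forall fun w => hM _ (mem_range_self w))
  have hfF : f = ∫ w, F w ∂μ := by
    ext z
    have h1 := (ContinuousMap.evalCLM ℂ z).integral_comp_comm hFi
    rw [ContinuousMap.evalCLM_apply] at h1
    rw [← h1, hf, ← integral_subtype_comap hT.measurableSet]
    rfl
  rw [hfF]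
  refine integral_mem_of_isClosed
    (W := (Subalgebra.toSubmodule (rationalOn S L hLS).topologicalClosure).restrictScalars ℝ)
    (rationalOn S L hLS).isClosed_topologicalClosure hFi fun w => ?_
  refine Subalgebra.smul_mem _ (cauchyKernel_mem_closure hLS (w := w) (fun z => ?_) ?_) _
  · exact inv_mul_cancel₀ (hne (w, z))
  · by_cases hw : (w : ℂ) ∈ S
    · exact Or.inr (hST w w.2 hw)
    · exact Or.inl hw

/-- **Runge's theorem** for the part of a closed set `S` in a disc, with poles off `S`: the
approximation is uniform on a neighbourhood. -/
theorem exists_rational_near {S U : Set ℂ} (hS : IsClosed S) (hU : IsOpen U) (hSU : S ⊆ U)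
    {h : ℂ → ℂ} (hh : DifferentiableOn ℂ h U) (R : ℝ) :
    ∃ L ⊆ U, S ∩ Metric.closedBall 0 R ⊆ interior L ∧ ∀ ε > 0, ∃ N D : ℂ[X],
      (∀ z ∈ S ∪ L, D.eval z ≠ 0) ∧ ∀ z ∈ L, ‖N.eval z / D.eval z - h z‖ < ε := by
  have hc : ∀ r, IsCompact (S ∩ Metric.closedBall 0 r) := fun r =>
    (isCompact_closedBall 0 r).inter_left hS
  -- The radius `R + 1` leaves room for pole pushing: `V` contains the part of `S` in that closed
  -- disc, so a point of `T` on `S` has modulus above `R + 1`, while `L` is chosen inside the open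
  -- disc. The points of `T` off `S` also miss `L`, hence are admissible poles.
  obtain ⟨V, T, φ, hV, hLV, hVU, hT, hVT, hφ, hint⟩ := exists_cauchy_transform hU (hc (R + 1))
    (inter_subset_left.trans hSU) hh
  obtain ⟨L, hL, hSL, hLV'⟩ := exists_compact_between (hc R)
    (hV.inter (Metric.isOpen_ball (x := (0 : ℂ)) (ε := R + 1))) fun z hz =>
      ⟨hLV ⟨hz.1, Metric.closedBall_subset_closedBall (by linarith) hz.2⟩,
        Metric.closedBall_subset_ball (by linarith) hz.2⟩
  have hLU : L ⊆ U := fun z hz => hVU (hLV' hz).1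
  have := isCompact_iff_compactSpace.1 hL
  let f : C(L, ℂ) := ⟨fun z => h z, (hh.continuousOn.mono hLU).domRestrict⟩
  have hmem : f ∈ (rationalOn (S ∪ L) L subset_union_right).topologicalClosure := by
    refine mem_closure_of_cauchy_transform subset_union_right hT
      (hVT.mono_left fun z hz => (hLV' hz).1) ?_ hφ fun z => hint z (hLV' z.2).1
    intro w hwT hw z hz
    have hwV : w ∉ V := fun h => Set.disjoint_left.1 hVT h hwT
    rcases hw with hw | hw
    · have h1 : ‖z‖ < R + 1 := by simpa using (hLV' hz).2
      have h2 : R + 1 < ‖w‖ := by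
        by_contra h
        exact hwV (hLV ⟨hw, by simpa using not_lt.1 h⟩)
      exact h1.trans h2
    · exact absurd (hLV' hw).1 hwV
  refine ⟨L, hLU, hSL, fun ε hε => ?_⟩
  obtain ⟨g, ⟨N, D, hD, hg⟩, hgf⟩ := Metric.mem_closure_iff.1 hmem ε hε
  refine ⟨N, D, hD, fun z hz => ?_⟩
  rw [dist_comm, dist_eq_norm] at hgf
  have h1 := (ContinuousMap.norm_coe_le_norm (g - f) ⟨z, hz⟩).trans_lt hgf
  rw [ContinuousMap.sub_apply, hg] at h1
  exact h1

theorem differentiableOn_iteratedDeriv {U : Set ℂ} (hU : IsOpen U) {h : ℂ → ℂ}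
    (hh : DifferentiableOn ℂ h U) (l : ℕ) : DifferentiableOn ℂ (iteratedDeriv l h) U := by
  induction l with
  | zero => simpa using hh
  | succ l ih => rw [iteratedDeriv_succ]; exact ih.deriv hU

theorem tendstoLocallyUniformlyOn_iteratedDeriv {ι : Type*} {F : ι → ℂ → ℂ} {f : ℂ → ℂ}
    {φ : Filter ι} {U : Set ℂ} (hU : IsOpen U) (hF : ∀ᶠ n in φ, DifferentiableOn ℂ (F n) U)
    (hf : TendstoLocallyUniformlyOn F f φ U) (l : ℕ) :
    TendstoLocallyUniformlyOn (fun n => iteratedDeriv l (F n)) (iteratedDeriv l f) φ U := by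
  induction l with
  | zero => simpa using hf
  | succ l ih =>
    simp only [iteratedDeriv_succ]
    exact ih.deriv (hF.mono fun n hn => differentiableOn_iteratedDeriv hU hn l) hU

/-- Uniform approximation on the neighbourhood `L` passes to derivatives on compact subsets of its
interior, by Weierstrass' theorem. -/
theorem exists_rational_iteratedDeriv_near {S U : Set ℂ} (hS : IsClosed S) (hU : IsOpen U)
    (hSU : S ⊆ U) {h : ℂ → ℂ} (hh : DifferentiableOn ℂ h U) (R : ℝ) (n : ℕ) {ε : ℝ} (hε : 0 < ε) :
    ∃ N D : ℂ[X], (∀ z ∈ S, D.eval z ≠ 0) ∧ ∀ l ≤ n, ∀ z ∈ S ∩ Metric.closedBall 0 R,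
      ‖iteratedDeriv l (fun z => N.eval z / D.eval z) z - iteratedDeriv l h z‖ < ε := by
  obtain ⟨L, hLU, hSL, happ⟩ := exists_rational_near hS hU hSU hh R
  choose N D hD hND using fun k : ℕ => happ (1 / ((k : ℝ) + 1)) Nat.one_div_pos_of_nat
  have hdiff : ∀ k, DifferentiableOn ℂ (fun z => (N k).eval z / (D k).eval z) (interior L) :=
    fun k z hz => (analyticAt_div_eval _ _
      (hD k z (Or.inr (interior_subset hz)))).differentiableAt.differentiableWithinAt
  have htend : TendstoLocallyUniformlyOn (fun k z => (N k).eval z / (D k).eval z) h atTop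
      (interior L) := by
    refine TendstoUniformlyOn.tendstoLocallyUniformlyOn ?_
    rw [Metric.tendstoUniformlyOn_iff]
    intro δ hδ
    filter_upwards [tendsto_one_div_add_atTop_nhds_zero_nat.eventually_lt_const hδ] with k hk z hz
    rw [dist_comm, dist_eq_norm]
    exact (hND k z (interior_subset hz)).trans hk
  have hev : ∀ l ∈ Finset.range (n + 1), ∀ᶠ k in atTop, ∀ z ∈ S ∩ Metric.closedBall 0 R,
      ‖iteratedDeriv l (fun z => (N k).eval z / (D k).eval z) z - iteratedDeriv l h z‖ < ε := by
    intro l _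
    have h1 := tendstoLocallyUniformlyOn_iteratedDeriv isOpen_interior
      (Eventually.of_forall hdiff) htend l
    have h2 := (tendstoLocallyUniformlyOn_iff_forall_isCompact isOpen_interior).1 h1 _ hSL
      ((isCompact_closedBall 0 R).inter_left hS)
    filter_upwards [Metric.tendstoUniformlyOn_iff.1 h2 ε hε] with k hk z hz
    rw [← dist_eq_norm, dist_comm]
    exact hk z hz
  obtain ⟨k, hk⟩ := ((Filter.eventually_all_finset _).2 hev).exists
  exact ⟨N k, D k, fun z hz => hD k z (Or.inl hz), fun l hl =>
    hk l (Finset.mem_range.2 (Nat.lt_succ_of_le hl))⟩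

end Runge

/-! ### The space `A^∞(Ω)`: holomorphic elements, completeness, convergence -/

variable {Ω : Set ℂ}

/-- The element of `A^∞(Ω)` given by a function holomorphic near `closure Ω`. -/
def ofHolomorphic {U : Set ℂ} {h : ℂ → ℂ} (hU : IsOpen U) (hΩU : closure Ω ⊆ U)
    (hh : DifferentiableOn ℂ h U) : AInf Ω :=
  ⟨fun l => ⟨fun z => iteratedDeriv l h z,
    ((differentiableOn_iteratedDeriv hU hh l).continuousOn.mono hΩU).domRestrict⟩,
    h, hh.mono (subset_closure.trans hΩU), fun _ _ _ => rfl⟩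

theorem der_ofHolomorphic {U : Set ℂ} {h : ℂ → ℂ} (hU : IsOpen U) (hΩU : closure Ω ⊆ U)
    (hh : DifferentiableOn ℂ h U) (l : ℕ) (z : closure Ω) :
    der (ofHolomorphic hU hΩU hh) l z = iteratedDeriv l h z := rfl

theorem ofHolomorphic_mem_holomorphicNear {U : Set ℂ} {h : ℂ → ℂ} (hU : IsOpen U)
    (hΩU : closure Ω ⊆ U) (hh : DifferentiableOn ℂ h U) :
    ofHolomorphic hU hΩU hh ∈ holomorphicNear Ω :=
  ⟨U, h, hU, hΩU, hh, fun z => by rw [der_ofHolomorphic, iteratedDeriv_zero]⟩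

/-- `holomorphicNear` prescribes only the values of `f`. The derivatives agree on the open set `Ω`,
and then on its closure by continuity and density. -/
theorem der_eq_iteratedDeriv (hΩ : IsOpen Ω) {f : AInf Ω} {U : Set ℂ} {h : ℂ → ℂ} (hU : IsOpen U)
    (hΩU : closure Ω ⊆ U) (hh : DifferentiableOn ℂ h U) (hf : ∀ z : closure Ω, der f 0 z = h z)
    (l : ℕ) (z : closure Ω) : der f l z = iteratedDeriv l h z := by
  obtain ⟨h', -, hf'⟩ := f.2
  have heq : ∀ z ∈ Ω, h' z = h z := fun z hz => by
    have h1 := hf' 0 ⟨z, subset_closure hz⟩ hz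
    rw [iteratedDeriv_zero] at h1
    rw [← h1]
    exact hf ⟨z, subset_closure hz⟩
  have hdense : Dense {z : closure Ω | (z : ℂ) ∈ Ω} := by
    rw [Subtype.dense_iff]
    intro z hz
    have : Subtype.val '' {z : closure Ω | (z : ℂ) ∈ Ω} = Ω := by
      ext w
      constructor
      · rintro ⟨v, hv, rfl⟩
        exact hv
      · exact fun hw => ⟨⟨w, subset_closure hw⟩, hw, rfl⟩
    rwa [this]
  have hc : Continuous fun z : closure Ω => iteratedDeriv l h z :=
    ((differentiableOn_iteratedDeriv hU hh l).continuousOn.mono hΩU).domRestrict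
  have hc' : Continuous (der f l) := ((f : ℕ → C(closure Ω, ℂ)) l).continuous
  refine congrFun (hc'.ext_on hdense hc fun z hz => ?_) z
  have hev : h' =ᶠ[𝓝 (z : ℂ)] h := by
    filter_upwards [hΩ.mem_nhds hz] with w hw using heq w hw
  exact (hf' l z hz).trans (hev.iteratedDeriv_eq l)

theorem isClosed_AInf (hΩ : IsOpen Ω) : IsClosed (AInf Ω) := by
  refine isClosed_of_closure_subset fun f hf => ?_
  -- The elements of `AInf Ω` themselves index a filter converging to `f`, so Weierstrass' theorem
  -- applies to the chosen holomorphic representatives `H`.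
  have hne : (comap ((↑) : AInf Ω → ℕ → C(closure Ω, ℂ)) (𝓝 f)).NeBot :=
    mem_closure_iff_comap_neBot.1 hf
  set φ := comap ((↑) : AInf Ω → ℕ → C(closure Ω, ℂ)) (𝓝 f)
  have ht : Tendsto ((↑) : AInf Ω → ℕ → C(closure Ω, ℂ)) φ (𝓝 f) := tendsto_comap
  choose H hH hHder using fun g : AInf Ω => g.2
  classical
  let h : ℂ → ℂ := fun z => if hz : z ∈ closure Ω then f 0 ⟨z, hz⟩ else 0
  have hunif : TendstoLocallyUniformlyOn H h φ Ω := by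
    rw [tendstoLocallyUniformlyOn_iff_forall_isCompact hΩ]
    intro K hKΩ hK
    have hK' : IsCompact ((↑) ⁻¹' K : Set (closure Ω)) :=
      isClosed_closure.isClosedEmbedding_subtypeVal.isCompact_preimage hK
    have h0 := ContinuousMap.tendsto_iff_forall_isCompact_tendstoUniformlyOn.1
      (tendsto_pi_nhds.1 ht 0) _ hK'
    rw [Metric.tendstoUniformlyOn_iff] at h0 ⊢
    intro ε hε
    filter_upwards [h0 ε hε] with g hg z hz
    have hz' : z ∈ closure Ω := subset_closure (hKΩ hz)
    have h1 := hg ⟨z, hz'⟩ hz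
    rw [hHder g 0 ⟨z, hz'⟩ (hKΩ hz), iteratedDeriv_zero] at h1
    simpa only [h, dif_pos hz'] using h1
  refine ⟨h, hunif.differentiableOn (Eventually.of_forall hH) hΩ, fun l z hz => ?_⟩
  have h1 := (tendstoLocallyUniformlyOn_iteratedDeriv hΩ (Eventually.of_forall hH) hunif
    l).tendsto_at hz
  have h2 : Tendsto (fun g : AInf Ω => (g : ℕ → C(closure Ω, ℂ)) l z) φ (𝓝 (f l z)) :=
    ((continuous_eval_const z).tendsto _).comp (tendsto_pi_nhds.1 ht l)
  refine tendsto_nhds_unique h2 (h1.congr fun g => ?_)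
  exact (hHder g l z hz).symm

/-- Completeness passes to closed subsets; σ-compactness and local compactness of `closure Ω` make
the uniformity countably generated, as Baire's theorem needs. -/
theorem baireSpace_XInf (hΩ : IsOpen Ω) : BaireSpace (XInf Ω) := by
  have h1 : CompleteSpace (AInf Ω) := (isClosed_AInf hΩ).completeSpace_coe
  have h2 : CompleteSpace (XInf Ω) := isClosed_closure.completeSpace_coe
  infer_instance

theorem tendsto_AInf {ι : Type*} {φ : Filter ι} {F : ι → AInf Ω} {f : AInf Ω}
    (h : ∀ (l : ℕ) (R : ℝ), ∀ ε > 0, ∀ᶠ i in φ, ∀ z : closure Ω, (z : ℂ) ∈ Metric.closedBall 0 R →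
      ‖der (F i) l z - der f l z‖ < ε) : Tendsto F φ (𝓝 f) := by
  rw [tendsto_subtype_rng, tendsto_pi_nhds]
  intro l
  rw [ContinuousMap.tendsto_iff_forall_isCompact_tendstoUniformlyOn]
  intro K hK
  rw [Metric.tendstoUniformlyOn_iff]
  intro ε hε
  obtain ⟨R, hR⟩ := (hK.image continuous_subtype_val).isBounded.subset_closedBall 0
  filter_upwards [h l R ε hε] with i hi z hz
  rw [dist_comm, dist_eq_norm]
  exact hi z (hR ⟨z, hz, rfl⟩)

/-! ### Density of rational functions in lowest terms -/

/-- Cancelling the gcd preserves the germs along `S`, and thus all derivatives there. -/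
theorem exists_coprime_rational (S : Set ℂ) (N D : ℂ[X]) (hD : ∀ z ∈ S, D.eval z ≠ 0) :
    ∃ N' D' : ℂ[X], IsCoprime N' D' ∧ D' ≠ 0 ∧ (∀ z ∈ S, D'.eval z ≠ 0) ∧
      ∀ z ∈ S, (fun z => N'.eval z / D'.eval z) =ᶠ[𝓝 z] fun z => N.eval z / D.eval z := by
  by_cases hD0 : D = 0
  · refine ⟨0, 1, isCoprime_one_right, one_ne_zero, by simp, fun z hz => ?_⟩
    exact absurd (by simp [hD0]) (hD z hz)
  · set g := EuclideanDomain.gcd N D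
    obtain ⟨N', hN'⟩ := EuclideanDomain.gcd_dvd_left N D
    obtain ⟨D', hD'⟩ := EuclideanDomain.gcd_dvd_right N D
    have hg0 : g ≠ 0 := fun h => hD0 (EuclideanDomain.gcd_eq_zero_iff.1 h).2
    have hev : ∀ z, D.eval z ≠ 0 → g.eval z ≠ 0 ∧ D'.eval z ≠ 0 := fun z hz => by
      rw [hD', Polynomial.eval_mul] at hz
      exact ⟨left_ne_zero_of_mul hz, right_ne_zero_of_mul hz⟩
    refine ⟨N', D', ?_, ?_, fun z hz => (hev z (hD z hz)).2, fun z hz => ?_⟩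
    · refine ⟨EuclideanDomain.gcdA N D, EuclideanDomain.gcdB N D, mul_left_cancel₀ hg0 ?_⟩
      have := EuclideanDomain.gcd_eq_gcd_ab N D
      calc g * (EuclideanDomain.gcdA N D * N' + EuclideanDomain.gcdB N D * D')
          = g * N' * EuclideanDomain.gcdA N D + g * D' * EuclideanDomain.gcdB N D := by ring
        _ = N * EuclideanDomain.gcdA N D + D * EuclideanDomain.gcdB N D := by rw [← hN', ← hD']
        _ = g * 1 := by rw [← this, mul_one]
    · rintro rfl
      exact hD0 (by rw [hD', mul_zero])
    · filter_upwards [D.continuous.continuousAt.eventually_ne (hD z hz)] with w hw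
      obtain ⟨h1, h2⟩ := hev w hw
      have e1 : N.eval w = g.eval w * N'.eval w := by rw [← Polynomial.eval_mul, ← hN']
      have e2 : D.eval w = g.eval w * D'.eval w := by rw [← Polynomial.eval_mul, ← hD']
      rw [e1, e2, mul_div_mul_left _ _ h1]

/-- The element `N / D` of `A^∞(Ω)`, the polynomial `D` having no zeros in `closure Ω`. -/
def ofRational (N D : ℂ[X]) (hD : ∀ z ∈ closure Ω, D.eval z ≠ 0) : AInf Ω :=
  ofHolomorphic (U := {z | D.eval z ≠ 0}) (h := fun z => N.eval z / D.eval z)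
    (isOpen_ne_fun D.continuous continuous_const) hD fun _ hz =>
      (analyticAt_div_eval N D hz).differentiableAt.differentiableWithinAt

theorem der_ofRational (N D : ℂ[X]) (hD : ∀ z ∈ closure Ω, D.eval z ≠ 0) (l : ℕ)
    (z : closure Ω) :
    der (ofRational N D hD) l z = iteratedDeriv l (fun z => N.eval z / D.eval z) z := rfl

theorem ofRational_mem_holomorphicNear (N D : ℂ[X]) (hD : ∀ z ∈ closure Ω, D.eval z ≠ 0) :
    ofRational N D hD ∈ holomorphicNear Ω :=
  ofHolomorphic_mem_holomorphicNear _ _ _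

theorem holomorphicNear_subset_closure_rational (hΩ : IsOpen Ω) :
    holomorphicNear Ω ⊆ closure {f | ∃ (N D : ℂ[X]) (hD : ∀ z ∈ closure Ω, D.eval z ≠ 0),
      IsCoprime N D ∧ D ≠ 0 ∧ f = ofRational N D hD} := by
  rintro f ⟨U, h, hU, hΩU, hh, hf⟩
  -- Order of derivative, radius and precision are all tied to `n`, so one sequence serves every
  -- seminorm.
  have key : ∀ n : ℕ, ∃ (N D : ℂ[X]) (hD : ∀ z ∈ closure Ω, D.eval z ≠ 0), IsCoprime N D ∧
      D ≠ 0 ∧ ∀ l ≤ n, ∀ z : closure Ω, (z : ℂ) ∈ Metric.closedBall 0 (n : ℝ) →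
        ‖der (ofRational N D hD) l z - der f l z‖ < 1 / ((n : ℝ) + 1) := by
    intro n
    obtain ⟨N, D, hD, hND⟩ := exists_rational_iteratedDeriv_near isClosed_closure hU hΩU hh n n
      (ε := 1 / ((n : ℝ) + 1)) Nat.one_div_pos_of_nat
    obtain ⟨N', D', hcop, hD0, hD', heq⟩ := exists_coprime_rational (closure Ω) N D hD
    refine ⟨N', D', hD', hcop, hD0, fun l hl z hz => ?_⟩
    rw [der_ofRational, (heq z z.2).iteratedDeriv_eq l, der_eq_iteratedDeriv hΩ hU hΩU hh hf]
    exact hND l hl z ⟨z.2, hz⟩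
  choose N D hD hcop hD0 happ using key
  refine mem_closure_of_tendsto (f := fun n => ofRational (N n) (D n) (hD n)) (b := atTop) ?_
    (Eventually.of_forall fun n => ⟨N n, D n, hD n, hcop n, hD0 n, rfl⟩)
  refine tendsto_AInf fun l R ε hε => ?_
  obtain ⟨M, hM⟩ := exists_nat_ge R
  filter_upwards [tendsto_one_div_add_atTop_nhds_zero_nat.eventually_lt_const hε,
    eventually_ge_atTop l, eventually_ge_atTop M] with n h1 h2 h3 z hz
  refine (happ n l h2 z (Metric.closedBall_subset_closedBall ?_ hz)).trans h1
  exact hM.trans (by exact_mod_cast h3)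

/-! ### Perturbation to the exact numerator degree -/

theorem iteratedDeriv_perturbation (N D : ℂ[X]) (c : ℂ) (t l : ℕ) {z : ℂ} (hz : D.eval z ≠ 0) :
    iteratedDeriv l (fun z => (N + C c * X ^ t * D).eval z / D.eval z) z =
      iteratedDeriv l (fun z => N.eval z / D.eval z) z +
        c * iteratedDeriv l (fun z => (X ^ t : ℂ[X]).eval z) z := by
  have h1 : (fun z => (N + C c * X ^ t * D).eval z / D.eval z) =ᶠ[𝓝 z]
      (fun z => N.eval z / D.eval z) + fun z => c * (X ^ t : ℂ[X]).eval z := by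
    filter_upwards [D.continuous.continuousAt.eventually_ne hz] with w hw
    simp only [Polynomial.eval_add, Polynomial.eval_mul, Polynomial.eval_C, Pi.add_apply]
    rw [add_div, mul_div_cancel_right₀ _ hw]
  have h2 : ContDiffAt ℂ l (fun z => (X ^ t : ℂ[X]).eval z) z := (analyticAt_eval _ z).contDiffAt
  rw [h1.iteratedDeriv_eq l, iteratedDeriv_add (analyticAt_div_eval N D hz).contDiffAt
    (contDiffAt_const.mul h2), iteratedDeriv_const_mul_field]

/-- The added term has degree exactly `p`, above that of `N`, so its leading coefficient survives.
-/
theorem natDegree_perturbation {N D : ℂ[X]} (hD : D ≠ 0) {c : ℂ} (hc : c ≠ 0) {p : ℕ}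
    (hp : N.natDegree + D.natDegree < p) :
    (N + C c * X ^ (p - D.natDegree) * D).natDegree = p := by
  have h1 : (C c * X ^ (p - D.natDegree) * D).natDegree = p := by
    rw [Polynomial.natDegree_mul (by simp [hc]) hD, Polynomial.natDegree_C_mul_X_pow _ _ hc]
    omega
  rw [Polynomial.natDegree_add_eq_right_of_natDegree_lt (by omega), h1]

/-- Adding a multiple of `D` to the numerator keeps it coprime to `D`. Intersecting with
`holomorphicNear Ω` keeps the approximants in `XInf Ω`, so that density can be read off inside that
subspace. -/
theorem ofRational_mem_closure_goodSet {𝓕 : Set (ℕ × ℕ)} {p q : ℕ → ℕ}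
    (h𝓕 : ∀ n, (p n, q n) ∈ 𝓕) (hp : Tendsto p atTop atTop) (hq : Tendsto q atTop atTop)
    {N D : ℂ[X]} (hD : ∀ z ∈ closure Ω, D.eval z ≠ 0) (hcop : IsCoprime N D) (hD0 : D ≠ 0)
    (K : Set (closure Ω)) (n : ℕ) {ε : ℝ} (hε : 0 < ε) :
    ofRational N D hD ∈ closure ((⋃ r ∈ 𝓕, goodSet K n ε r.1 r.2) ∩ holomorphicNear Ω) := by
  obtain ⟨m, hpm, hqm⟩ := ((hp.eventually_gt_atTop (N.natDegree + D.natDegree)).and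
    (hq.eventually_ge_atTop D.natDegree)).exists
  set t := p m - D.natDegree
  -- The index `m`, and so the exponent `t`, is fixed before `c → 0`; the punctured neighbourhood is
  -- needed because the degree is `p m` only for `c ≠ 0`.
  have htend : Tendsto (fun c : ℂ => ofRational (N + C c * X ^ t * D) D hD) (𝓝[≠] 0)
      (𝓝 (ofRational N D hD)) := by
    refine Tendsto.mono_left ?_ nhdsWithin_le_nhds
    refine tendsto_AInf fun l R δ hδ => ?_
    have hcont : Continuous fun z : ℂ => iteratedDeriv l (fun z => (X ^ t : ℂ[X]).eval z) z :=
      continuousOn_univ.1 (differentiableOn_iteratedDeriv isOpen_univ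
        (X ^ t : ℂ[X]).differentiable.differentiableOn l).continuousOn
    obtain ⟨M, hM⟩ := ((isCompact_closedBall (0 : ℂ) R).image hcont).isBounded.exists_norm_le
    have hsmall : Tendsto (fun c : ℂ => ‖c‖ * M) (𝓝 0) (𝓝 0) := by
      simpa using (continuous_norm.mul_const M).tendsto (0 : ℂ)
    filter_upwards [hsmall.eventually_lt_const hδ] with c hc z hz
    rw [der_ofRational, der_ofRational, iteratedDeriv_perturbation _ _ _ _ _ (hD z z.2),
      add_sub_cancel_left, norm_mul]
    exact (mul_le_mul_of_nonneg_left (hM _ ⟨z, hz, rfl⟩) (norm_nonneg c)).trans_lt hc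
  refine mem_closure_of_tendsto htend ?_
  filter_upwards [self_mem_nhdsWithin] with c hc
  refine ⟨Set.mem_biUnion (h𝓕 m) fun x hx => ?_, ofRational_mem_holomorphicNear _ _ _⟩
  have hdeg := natDegree_perturbation hD0 hc hpm
  have hN0 : N + C c * X ^ t * D ≠ 0 := by
    intro h
    rw [h, Polynomial.natDegree_zero] at hdeg
    omega
  obtain ⟨h1, h2, h3⟩ := padePair_of_rational (Ω := Ω)
    (f := ofRational (N + C c * X ^ t * D) D hD) hN0 hqm
    (IsCoprime.add_mul_right_left hcop _) hD (fun l z => der_ofRational _ _ hD l z) x.1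
  rw [hdeg] at h1 h2 h3
  refine ⟨h1, h2 x.2 x.2.2, fun l _ => ?_⟩
  rw [h3, der_ofRational, sub_self, norm_zero]
  exact hε

theorem XInf_subset_closure_goodSet (hΩ : IsOpen Ω) {𝓕 : Set (ℕ × ℕ)}
    (h𝓕 : ∃ p q : ℕ → ℕ, (∀ n, (p n, q n) ∈ 𝓕) ∧ Tendsto p atTop atTop ∧ Tendsto q atTop atTop)
    (K : Set (closure Ω)) (n : ℕ) {ε : ℝ} (hε : 0 < ε) :
    XInf Ω ⊆ closure ((⋃ r ∈ 𝓕, goodSet K n ε r.1 r.2) ∩ holomorphicNear Ω) := by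
  obtain ⟨p, q, hpq, hp, hq⟩ := h𝓕
  refine closure_minimal ((holomorphicNear_subset_closure_rational hΩ).trans
    (closure_minimal ?_ isClosed_closure)) isClosed_closure
  rintro f ⟨N, D, hD, hcop, hD0, rfl⟩
  exact ofRational_mem_closure_goodSet hpq hp hq hD hcop hD0 K n hε

/-! ### Reduction to countably many open dense conditions -/

/-- The points of `closure Ω` in the disc of radius `n` about the origin. -/
def closedDisc (Ω : Set ℂ) (n : ℕ) : Set (closure Ω) :=
  {z | (z : ℂ) ∈ Metric.closedBall (0 : ℂ) n}

theorem isCompact_closedDisc (Ω : Set ℂ) (n : ℕ) : IsCompact (closedDisc Ω n) :=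
  isClosed_closure.isClosedEmbedding_subtypeVal.isCompact_preimage (isCompact_closedBall 0 _)

theorem exists_subset_closedDisc {K : Set (closure Ω)} (hK : IsCompact K) :
    ∃ M, ∀ n ≥ M, K ⊆ closedDisc Ω n := by
  obtain ⟨R, hR⟩ := (hK.image continuous_subtype_val).isBounded.subset_closedBall 0
  obtain ⟨M, hM⟩ := exists_nat_ge R
  refine ⟨M, fun n hn z hz => Metric.closedBall_subset_closedBall ?_ (hR ⟨z, hz, rfl⟩)⟩
  exact hM.trans (by exact_mod_cast hn)

/-- Every compact set lies in all sufficiently large discs. Conversely to extracting one index per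
disc, choosing a pair from `𝓕` for each `n` gives a diagonal sequence valid for all compact sets and
all orders. -/
theorem hasPadeApproximation_iff (𝓕 : Set (ℕ × ℕ)) (f : AInf Ω) :
    HasPadeApproximation 𝓕 f ↔ ∀ n : ℕ,
      f ∈ ⋃ r ∈ 𝓕, goodSet (closedDisc Ω n) n (1 / ((n : ℝ) + 1)) r.1 r.2 := by
  constructor
  · rintro ⟨p, q, hpq, h⟩ n
    obtain ⟨⟨n₀, hn₀⟩, hconv⟩ := h _ (isCompact_closedDisc Ω n)
    have hev : ∀ l ∈ Finset.range (n + 1), ∀ᶠ m in atTop, ∀ x ∈ closedDisc Ω n ×ˢ closedDisc Ω n,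
        ‖iteratedDeriv l (pade f (p m) (q m) x.1) x.2 - der f l x.2‖ < 1 / ((n : ℝ) + 1) := by
      intro l _
      filter_upwards [Metric.tendstoUniformlyOn_iff.1 (hconv l) _
        (Nat.one_div_pos_of_nat (n := n))] with m hm x hx
      rw [← dist_eq_norm, dist_comm]
      exact hm x hx
    obtain ⟨m, hm, hm₀⟩ := (((Filter.eventually_all_finset _).2 hev).and
      (eventually_ge_atTop n₀)).exists
    refine Set.mem_biUnion (hpq m) fun x hx => ?_
    obtain ⟨h1, h2⟩ := hn₀ m hm₀ x.1 hx.1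
    exact ⟨h1, h2 x.2 hx.2, fun l hl => hm l (Finset.mem_range.2 (Nat.lt_succ_of_le hl)) x hx⟩
  · intro h
    simp only [Set.mem_iUnion, exists_prop] at h
    choose r hr hgood using h
    refine ⟨fun n => (r n).1, fun n => (r n).2, hr, fun K hK => ?_⟩
    obtain ⟨M, hM⟩ := exists_subset_closedDisc hK
    refine ⟨⟨M, fun n hn ζ hζ => ⟨?_, fun z hz => ?_⟩⟩, fun l => ?_⟩
    · exact (hgood n (ζ, ζ) ⟨hM n hn hζ, hM n hn hζ⟩).1
    · exact (hgood n (ζ, z) ⟨hM n hn hζ, hM n hn hz⟩).2.1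
    · rw [Metric.tendstoUniformlyOn_iff]
      intro ε hε
      filter_upwards [tendsto_one_div_add_atTop_nhds_zero_nat.eventually_lt_const hε,
        eventually_ge_atTop l, eventually_ge_atTop M] with n h1 h2 h3 x hx
      rw [dist_comm, dist_eq_norm]
      exact ((hgood n x ⟨hM n h3 hx.1, hM n h3 hx.2⟩).2.2 l h2).trans h1

theorem isOpen_iUnion_goodSet (𝓕 : Set (ℕ × ℕ)) (n : ℕ) : IsOpen {f : XInf Ω | (f : AInf Ω) ∈
    ⋃ r ∈ 𝓕, goodSet (closedDisc Ω n) n (1 / ((n : ℝ) + 1)) r.1 r.2} :=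
  (isOpen_biUnion fun _ _ => isOpen_goodSet (isCompact_closedDisc Ω n) n _ _ _).preimage
    continuous_subtype_val

theorem dense_iUnion_goodSet (hΩ : IsOpen Ω) {𝓕 : Set (ℕ × ℕ)}
    (h𝓕 : ∃ p q : ℕ → ℕ, (∀ n, (p n, q n) ∈ 𝓕) ∧ Tendsto p atTop atTop ∧ Tendsto q atTop atTop)
    (n : ℕ) : Dense {f : XInf Ω | (f : AInf Ω) ∈
      ⋃ r ∈ 𝓕, goodSet (closedDisc Ω n) n (1 / ((n : ℝ) + 1)) r.1 r.2} := by
  rw [Subtype.dense_iff]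
  intro f hf
  refine closure_mono ?_ (XInf_subset_closure_goodSet hΩ h𝓕 (closedDisc Ω n) n
    (Nat.one_div_pos_of_nat (n := n)) hf)
  rintro g ⟨hg, hg'⟩
  exact ⟨⟨g, subset_closure hg'⟩, hg, rfl⟩

end PadeGeneric

end

theorem theorem6p6 (Ω : Set ℂ) (hΩ : IsOpen Ω) (𝓕 : Set (ℕ × ℕ))
    (h𝓕 : ∃ p q : ℕ → ℕ, (∀ n, (p n, q n) ∈ 𝓕) ∧ Tendsto p atTop atTop ∧ Tendsto q atTop atTop) :
    (∃ f : PadeGeneric.AInf Ω, PadeGeneric.HasPadeApproximation 𝓕 f) ∧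
    IsGδ {f : PadeGeneric.XInf Ω | PadeGeneric.HasPadeApproximation 𝓕 (f : PadeGeneric.AInf Ω)} ∧
    Dense {f : PadeGeneric.XInf Ω | PadeGeneric.HasPadeApproximation 𝓕 (f : PadeGeneric.AInf Ω)} := by
  have heq : {f : PadeGeneric.XInf Ω |
      PadeGeneric.HasPadeApproximation 𝓕 (f : PadeGeneric.AInf Ω)} =
      ⋂ n : ℕ, {f : PadeGeneric.XInf Ω | (f : PadeGeneric.AInf Ω) ∈ ⋃ r ∈ 𝓕,
        PadeGeneric.goodSet (PadeGeneric.closedDisc Ω n) n (1 / ((n : ℝ) + 1)) r.1 r.2} := by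
    ext f
    simp only [Set.mem_ofPred_eq, Set.mem_iInter, PadeGeneric.hasPadeApproximation_iff]
  have hbaire := PadeGeneric.baireSpace_XInf hΩ
  have hdense : Dense {f : PadeGeneric.XInf Ω |
      PadeGeneric.HasPadeApproximation 𝓕 (f : PadeGeneric.AInf Ω)} := by
    rw [heq]
    exact dense_iInter_of_isOpen (fun n => PadeGeneric.isOpen_iUnion_goodSet 𝓕 n)
      fun n => PadeGeneric.dense_iUnion_goodSet hΩ h𝓕 n
  refine ⟨?_, ?_, hdense⟩
  · have hne : Nonempty (PadeGeneric.XInf Ω) :=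
      ⟨⟨_, subset_closure (PadeGeneric.ofRational_mem_holomorphicNear 0 1 (by simp))⟩⟩
    obtain ⟨f, hf⟩ := hdense.nonempty
    exact ⟨f, hf⟩
  · rw [heq]
    exact IsGδ.iInter_of_isOpen fun n => PadeGeneric.isOpen_iUnion_goodSet 𝓕 n
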